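/- **Notation.** For $x\in\mathbb R^3$ let $S(x)$ be the skew-symmetric matrix with $S(x)y=x\times y$, let $e_3=(0,0,1)^{\mathsf T}$, and let $\|\cdot\|$ be the Euclidean norm. For a unit quaternion $Q=(\eta,q)\in\mathbb R\times\mathbb R^3$, $\eta^2+\|q\|^2=1$, put $R(Q)=I+2S(q)^2-2\eta S(q)$ and $Q^{-1}=(\eta,-q)$; the product is $(\eta_1,q_1)\odot(\eta_2,q_2)=(\eta_1\eta_2-q_1^{\mathsf T}q_2,\ \eta_1q_2+\eta_2q_1+S(q_1)q_2)$. Let $h(u)=(1+u^{\mathsf T}u)^{-1/2}u$ and $\phi(u)=\partial h/\partial u=(1+u^{\mathsf T}u)^{-3/2}(I-S(u)^2)$. For $\mu\in\mathbb R^3$ with $\|\mu\|<g$ put $u=\|\mu-ge_3\|$ and $$\eta_d(\mu)=\Big(\tfrac12\big(1+\tfrac{g-e_3^{\mathsf T}\mu}{u}\big)\Big)^{1/2},\qquad Q_d(\mu)=\Big(\eta_d,\ \tfrac{1}{2u\,\eta_d}S(\mu)e_3\Big),$$ $$M(\mu)=\tfrac{1}{4\eta_d^2u^4}\big(-4S(\mu)e_3e_3^{\mathsf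 T}+4\eta_d^2u\,S(e_3)+2S(\mu)-2(e_3^{\mathsf T}\mu)S(e_3)\big)S(\mu-ge_3)^2 .$$ **System.** Let $k_p,k_v>0$ with $k_p+k_v<g$, let $r_1,p_r\in\mathbb R^3$ be constant, and let $e_p=p-p_r$. The VTOL vehicle with position $p$, velocity $v$ and attitude $Q=(\eta,q)$, $R=R(Q)$, obeys $$\dot p=v,\qquad \dot v=ge_3-u_tR^{\mathsf T}e_3+\delta(v),\qquad \dot Q=\tfrac12\big(-q^{\mathsf T}\omega,\ (\eta I+S(q))\omega\big).$$ Write $r_2=-u_tR^{\mathsf T}e_3+\delta(v)$, $b_1=Rr_1$, $b_2=Rr_2$. For gains $\gamma_1,\gamma_2,k_1>0$ apply, with $Q_d=Q_d(\mu_d)$ and $R_d=R(Q_d)$, $$\mu_d=-k_ph(e_p)-k_vh(v),\qquad u_t=\|\mu_d-ge_3\|,$$ $$\omega=M(\mu_d)\big(f_{\mu_d}-k_v\phi(v)R_d^{\mathsf T}(b_2+u_te_3)\big)+\psi,\qquad f_{\mu_d}=-k_p\phi(e_p)v+k_v\phi(v)\big(k_ph(e_p)+k_vh(v)\big),$$ $$\psi=\gamma_1S(R_dr_1)b_1+\gamma_2k_1S\big(R_d(v-\hat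 v)\big)b_2,\qquad \dot{\hat v}=ge_3+R_d^{\mathsf T}b_2+k_1(v-\hat v)+\tfrac1{k_1}R_d^{\mathsf T}S(b_2)\psi .$$ Let $\tilde Q=(\tilde\eta,\tilde q)=Q\odot Q_d^{-1}$, $\tilde R=R(\tilde Q)$ be the attitude error and $\tilde r_2=k_1(v-\hat v)-(I-\tilde R)r_2$ the filter error. **Assumptions.** (Non-collinearity) A function $c_w(a,b)>0$ of $a,b>0$ is given, and for all $a,b>0$ the smallest eigenvalue of $-aS(r_1)^2-bS(r_2)^2$ exceeds $c_w(a,b)$ at all times along the solution. (Aerodynamic forces) Constants $c_1,c_2,c_3>0$ are given; $\delta$ is a function of $v$ only with $\delta(v)^{\mathsf T}v\le0$ and $\|\delta(v)\|\le c_1\|v\|^2$, and along the solution $\delta$ is differentiable in time with $\|\dot\delta\|<c_2+c_3\|v\|^3$. The function $c_w$ and the constants $c_i$ do not depend on $\gamma_1,\gamma_2,k_1$ or on the solution. **Theorem.** (i) Along every solution, for all $\gamma_1,\gamma_2,k_1>0$, the thrust satisfies $0<g-k_p-k_v\le u_t(t)\le g+k_p+k_v$. (ii) Fix $t_0$, initial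 values $p(t_0),v(t_0),Q(t_0)$ with $Q(t_0)$ a unit quaternion and $\tilde\eta(t_0)\ne0$, and a bound $B$ for the initial filter error. There are $\bar\gamma_1,\bar\gamma_2>0$ such that for all $\gamma_1>\bar\gamma_1$ and $\gamma_2>\bar\gamma_2$ there is $\kappa_1>0$ such that for all $k_1>\kappa_1$ the following holds. For every solution of the closed loop on an interval $[t_0,T)$, $T\le\infty$, that satisfies the assumptions, has these initial values and has $\|\tilde r_2(t_0)\|\le B$ (with $B=2\|r_2(t_0)\|$ this admits the initialization $\hat v(t_0)=v(t_0)$), $e_p$ and $v$ are bounded on $[t_0,T)$; and if $T=\infty$, then $\lim_{t\to\infty}e_p(t)=\lim_{t\to\infty}v(t)=0$. -/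

import Mathlib

namespace VTOL

noncomputable section

/-- `ℝ³` with the Euclidean norm. -/
abbrev E3 := EuclideanSpace ℝ (Fin 3)

/-- Real `3 × 3` matrices. -/
abbrev Mat3 := Matrix (Fin 3) (Fin 3) ℝ

/-- The matrix-vector product `A x` on `ℝ³`. -/
abbrev act (A : Mat3) (x : E3) : E3 := Matrix.toEuclideanLin A x

/-- `e₃ = (0, 0, 1)`. -/
def e3 : E3 := !₂[0, 0, 1]

/-- The skew-symmetric matrix `S(x)` with `S(x) y = x × y`. -/
def S (x : E3) : Mat3 :=
  !![0, -x 2, x 1;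
     x 2, 0, -x 0;
     -x 1, x 0, 0]

/-! ### Quaternions `Q = (η, q)`, with scalar part `Q.1` and vector part `Q.2` -/

/-- `Q` is a unit quaternion. -/
def IsUnitQuat (Q : ℝ × E3) : Prop := Q.1 ^ 2 + ‖Q.2‖ ^ 2 = 1

/-- The quaternion product. -/
def qmul (Q₁ Q₂ : ℝ × E3) : ℝ × E3 :=
  (Q₁.1 * Q₂.1 - inner ℝ Q₁.2 Q₂.2, Q₁.1 • Q₂.2 + Q₂.1 • Q₁.2 + act (S Q₁.2) Q₂.2)

/-- The inverse of a unit quaternion. -/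
def qinv (Q : ℝ × E3) : ℝ × E3 := (Q.1, -Q.2)

/-- The rotation matrix `R(Q) = I + 2 S(q)² - 2 η S(q)`. -/
def rot (Q : ℝ × E3) : Mat3 := 1 + (2 : ℝ) • S Q.2 ^ 2 - (2 * Q.1) • S Q.2

/-- The right-hand side `½ (-qᵀ ω, (η I + S(q)) ω)` of the attitude kinematics. -/
def quatRate (Q : ℝ × E3) (ω : E3) : ℝ × E3 :=
  (-(1 / 2) * inner ℝ Q.2 ω, (1 / 2 : ℝ) • (Q.1 • ω + act (S Q.2) ω))

/-! ### The bounded function `h` and its Jacobian `φ` -/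

/-- `h(u) = (1 + uᵀu)^{-1/2} u`. -/
def h (u : E3) : E3 := (Real.sqrt (1 + ‖u‖ ^ 2))⁻¹ • u

/-- `φ(u) = (1 + uᵀu)^{-3/2} (I - S(u)²)`. -/
def phi (u : E3) : Mat3 := ((Real.sqrt (1 + ‖u‖ ^ 2)) ^ 3)⁻¹ • (1 - S u ^ 2)

/-! ### Thrust and attitude extraction from a desired acceleration `μ` -/

/-- The thrust `‖μ - g e₃‖`. -/
def thrust (g : ℝ) (μ : E3) : ℝ := ‖μ - g • e3‖

/-- The scalar part of the desired attitude. -/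
def etaD (g : ℝ) (μ : E3) : ℝ :=
  Real.sqrt (1 / 2 * (1 + (g - inner ℝ e3 μ) / ‖μ - g • e3‖))

/-- The desired attitude `Q_d = (η_d, q_d)`. -/
def attD (g : ℝ) (μ : E3) : ℝ × E3 :=
  (etaD g μ, (1 / (2 * ‖μ - g • e3‖ * etaD g μ)) • act (S μ) e3)

/-- The matrix `M(μ)`, which gives the desired angular velocity `ω_d = M(μ_d) dμ_d/dt`. -/
def M (g : ℝ) (μ : E3) : Mat3 :=
  (1 / (4 * etaD g μ ^ 2 * thrust g μ ^ 4)) •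
    ((-(4 : ℝ) • (S μ * Matrix.vecMulVec e3 e3)
        + (4 * etaD g μ ^ 2 * thrust g μ) • S e3
        + (2 : ℝ) • S μ
        - (2 * inner ℝ e3 μ) • S e3) * S (μ - g • e3) ^ 2)

/-! ### The vehicle, the gains and the closed loop -/

/-- Data of the vehicle, its environment and its task. -/
structure Vehicle where
  /-- gravitational acceleration -/
  g : ℝ
  /-- constant magnetic field, in the inertial frame -/
  r₁ : E3
  /-- aerodynamic disturbance, as a function of the translational velocity -/
  δ : E3 → E3
  /-- constant reference position -/
  pr : E3

/-- The control gains. -/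
structure Gains where
  kp : ℝ
  kv : ℝ
  γ₁ : ℝ
  γ₂ : ℝ
  k₁ : ℝ

/-- Position, velocity, attitude and filter variable. -/
structure State where
  p : E3
  v : E3
  Q : ℝ × E3
  vhat : E3

section ClosedLoop

variable (P : Vehicle) (K : Gains) (X : State)

/-- Position error `e_p = p - p_r`. -/
def eP : E3 := X.p - P.pr

/-- Virtual control law `μ_d = -k_p h(e_p) - k_v h(v)`. -/
def muD : E3 := -(K.kp • h (eP P X)) - K.kv • h X.v

/-- Thrust input `u_t = ‖μ_d - g e₃‖`. -/
def uT : ℝ := thrust P.g (muD P K X)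

/-- Desired attitude `Q_d`. -/
def QD : ℝ × E3 := attD P.g (muD P K X)

/-- `R_d = R(Q_d)`. -/
def RD : Mat3 := rot (QD P K X)

/-- Attitude error `Q̃ = Q ⊙ Q_d⁻¹`. -/
def Qerr : ℝ × E3 := qmul X.Q (qinv (QD P K X))

/-- Apparent acceleration `r₂ = -u_t Rᵀ e₃ + δ`. -/
def r2 : E3 := -(uT P K X • act (rot X.Q).transpose e3) + P.δ X.v

/-- Magnetometer signal `b₁ = R r₁`. -/
def b1 : E3 := act (rot X.Q) P.r₁

/-- Accelerometer signal `b₂ = R r₂`. -/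
def b2 : E3 := act (rot X.Q) (r2 P K X)

/-- `ψ = γ₁ S(R_d r₁) b₁ + γ₂ k₁ S(R_d (v - v̂)) b₂`. -/
def psi : E3 :=
  K.γ₁ • act (S (act (RD P K X) P.r₁)) (b1 P X)
    + (K.γ₂ * K.k₁) • act (S (act (RD P K X) (X.v - X.vhat))) (b2 P K X)

/-- `f_{μ_d} = -k_p φ(e_p) v + k_v φ(v) (k_p h(e_p) + k_v h(v))`. -/
def fMuD : E3 :=
  -(K.kp • act (phi (eP P X)) X.v)
    + K.kv • act (phi X.v) (K.kp • h (eP P X) + K.kv • h X.v)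

/-- The angular velocity input
`ω = M(μ_d) (f_{μ_d} - k_v φ(v) R_dᵀ (b₂ + u_t e₃)) + ψ`. -/
def omega : E3 :=
  act (M P.g (muD P K X))
      (fMuD P K X
        - K.kv • act (phi X.v) (act (RD P K X).transpose (b2 P K X + uT P K X • e3)))
    + psi P K X

/-- Right-hand side of the filter equation for `v̂`. -/
def vhatRate : E3 :=
  P.g • e3 + act (RD P K X).transpose (b2 P K X) + K.k₁ • (X.v - X.vhat)
    + (1 / K.k₁) • act (RD P K X).transpose (act (S (b2 P K X)) (psi P K X))

/-- The filter error `r̃₂ = k₁ (v - v̂) - (I - R̃) r₂`, where `R̃ = R(Q̃)`. -/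
def r2err : E3 :=
  K.k₁ • (X.v - X.vhat) - act (1 - rot (Qerr P K X)) (r2 P K X)

end ClosedLoop

/-- The time interval `[t₀, T)`, where `T = ⊤` gives `[t₀, ∞)`. -/
def timeInterval (t₀ : ℝ) (T : EReal) : Set ℝ := {t | t₀ ≤ t ∧ (t : EReal) < T}

/-- `x` solves the closed-loop system on the time interval `J`. -/
structure IsSolution (P : Vehicle) (K : Gains) (J : Set ℝ) (x : ℝ → State) : Prop where
  position : ∀ t ∈ J, HasDerivWithinAt (fun s => (x s).p) (x t).v J t
  velocity : ∀ t ∈ J, HasDerivWithinAt (fun s => (x s).v)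
    (P.g • e3 - uT P K (x t) • act (rot (x t).Q).transpose e3 + P.δ (x t).v) J t
  attitude : ∀ t ∈ J, HasDerivWithinAt (fun s => (x s).Q)
    (quatRate (x t).Q (omega P K (x t))) J t
  filter : ∀ t ∈ J, HasDerivWithinAt (fun s => (x s).vhat) (vhatRate P K (x t)) J t

/-! ### The assumptions -/

/-- `W = -a S(r₁)² - b S(r₂)²`. -/
def W (a b : ℝ) (r₁ r₂ : E3) : Mat3 := -(a • S r₁ ^ 2) - b • S r₂ ^ 2

/-- The smallest eigenvalue of a real symmetric matrix. -/
def lambdaMin (A : Mat3) : ℝ := sInf (spectrum ℝ A)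

/-- The apparent acceleration is uniformly non-collinear to the magnetic field along `x`:
for all positive weights `a`, `b`, the number `cw a b` is a strict lower bound of the smallest
eigenvalue of `W`. -/
def NonCollinear (cw : ℝ → ℝ → ℝ) (P : Vehicle) (K : Gains) (J : Set ℝ) (x : ℝ → State) :
    Prop :=
  ∀ a b : ℝ, 0 < a → 0 < b → ∀ t ∈ J, cw a b < lambdaMin (W a b P.r₁ (r2 P K (x t)))

/-- Along `x` the aerodynamic disturbance is differentiable in time, and its derivative
satisfies `‖dδ/dt‖ < c₂ + c₃ ‖v‖³`. -/
def DisturbanceRate (c₂ c₃ : ℝ) (P : Vehicle) (J : Set ℝ) (x : ℝ → State) : Prop :=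
  ∀ t ∈ J, DifferentiableWithinAt ℝ (fun s => P.δ (x s).v) J t ∧
    ‖derivWithin (fun s => P.δ (x s).v) J t‖ < c₂ + c₃ * ‖(x t).v‖ ^ 3

end

end VTOL

/-! With perfect attitude tracking the translation would obey `v' = -k_p h(e_p) - k_v h(v) + δ(v)`,
for which the energy `V = k_p (√(1 + ‖e_p‖²) - 1) + ‖v‖²/2` does not increase. The true motion
differs by a thrust misalignment of size `O(‖q̃‖)`, so the task is to make `‖q̃‖` decay fast enough.

Attitude error. Since `r₂` is not known in the inertial frame, `k₁ (v - v̂) = r̃₂ + (I - R̃) r₂`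
stands in for it, and `R_dᵀ ψ` becomes `γ₁ r₁ × R̃r₁ + γ₂ r₂ × R̃r₂ + γ₂ r̃₂ × R̃r₂`
(`RD_transpose_psi`). The identity `q̃ᵀ (r × R̃r) = -2 η̃ ‖q̃ × r‖²` and non-collinearity then damp
`‖q̃‖²` at a rate proportional to `η̃²`, while `k₁` damps `r̃₂`. Hence `L = ‖q̃‖² + a ‖r̃₂‖²`
satisfies `L' ≤ -Λ L` for any prescribed `Λ` and suitable gains, provided that `‖v‖ ≤ vb` and `η̃² ≥
ε²/4`, where `ε = η̃(t₀)` (`attLyapunovRate_bound`, `IsSolution.exists_attLyapunovRate`).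

Removing the provisos. Below the levels `V(t₀) + 1` for `V + L/2` and `1 - ε²/4` for `L`, both
provisos hold and, for large `Λ`, neither function increases. Both start strictly below their
levels, so they stay there (`le_initial_of_bootstrap`, `IsSolution.bounded_of_attLyapunovRate`).
There is no circularity in the constants: `vb` comes from the initial energy alone, then `Λ`, the
thresholds of `γ₁`, `γ₂`, the weight `a`, and finally the threshold of `k₁`.

Convergence. On the bounded set so obtained, `V + α e_pᵀv + n L`, with `α` small and `n` large, is a
strict Lyapunov function with exponential decay (`IsSolution.tendsto_zero`). -/

namespace VTOL

noncomputable section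

/-! ### Vector algebra in `ℝ³` -/

/-- The cross product on `ℝ³`. -/
def cross (x y : E3) : E3 :=
  !₂[x 1 * y 2 - x 2 * y 1, x 2 * y 0 - x 0 * y 2, x 0 * y 1 - x 1 * y 0]

@[simp] lemma cross_apply_zero (x y : E3) : cross x y 0 = x 1 * y 2 - x 2 * y 1 := rfl
@[simp] lemma cross_apply_one (x y : E3) : cross x y 1 = x 2 * y 0 - x 0 * y 2 := rfl
@[simp] lemma cross_apply_two (x y : E3) : cross x y 2 = x 0 * y 1 - x 1 * y 0 := rfl

@[simp] lemma e3_apply_zero : e3 0 = 0 := rfl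
@[simp] lemma e3_apply_one : e3 1 = 0 := rfl
@[simp] lemma e3_apply_two : e3 2 = 1 := rfl

lemma ext3 {x y : E3} (h0 : x 0 = y 0) (h1 : x 1 = y 1) (h2 : x 2 = y 2) : x = y := by
  ext i; fin_cases i <;> assumption

lemma inner_coord (x y : E3) : inner ℝ x y = x 0 * y 0 + x 1 * y 1 + x 2 * y 2 := by
  simp [PiLp.inner_apply, Fin.sum_univ_three, mul_comm]

lemma norm_sq_coord (x : E3) : ‖x‖ ^ 2 = x 0 ^ 2 + x 1 ^ 2 + x 2 ^ 2 := by
  rw [EuclideanSpace.real_norm_sq_eq, Fin.sum_univ_three]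

lemma abs_coord_le (x : E3) (i : Fin 3) : |x i| ≤ ‖x‖ := by
  simpa using PiLp.norm_apply_le x i

lemma norm_e3 : ‖e3‖ = 1 := by
  have h := norm_sq_coord e3
  simp only [e3_apply_zero, e3_apply_one, e3_apply_two] at h
  have := norm_nonneg e3
  nlinarith

lemma act_S (x y : E3) : act (S x) y = cross x y := by
  apply ext3 <;>
    simp [act, S, Matrix.toLpLin_apply, dotProduct, Fin.sum_univ_three] <;> ring

lemma act_mul (A B : Mat3) (x : E3) : act (A * B) x = act A (act B x) := by
  simp [act]

lemma act_one (x : E3) : act 1 x = x := by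
  simp [act]

lemma act_add (A B : Mat3) (x : E3) : act (A + B) x = act A x + act B x := by
  simp [act]

lemma act_sub (A B : Mat3) (x : E3) : act (A - B) x = act A x - act B x := by
  simp [act]

lemma act_smul (c : ℝ) (A : Mat3) (x : E3) : act (c • A) x = c • act A x := by
  simp [act]

lemma act_add_right (A : Mat3) (x y : E3) : act A (x + y) = act A x + act A y := map_add _ _ _

lemma act_sub_right (A : Mat3) (x y : E3) : act A (x - y) = act A x - act A y := map_sub _ _ _

lemma act_neg_right (A : Mat3) (x : E3) : act A (-x) = -act A x := map_neg _ _

lemma act_smul_right (A : Mat3) (c : ℝ) (x : E3) : act A (c • x) = c • act A x := map_smul _ _ _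

lemma act_S_sq (x y : E3) : act (S x ^ 2) y = cross x (cross x y) := by
  rw [pow_two, act_mul, act_S, act_S]

lemma act_vecMulVec (a b x : E3) : act (Matrix.vecMulVec a b) x = inner ℝ b x • a := by
  apply ext3 <;>
    simp [act, inner_coord, Matrix.toLpLin_apply, Matrix.mulVec, dotProduct,
      Matrix.vecMulVec_apply, Fin.sum_univ_three] <;> ring

lemma inner_act_transpose (A : Mat3) (x y : E3) :
    inner ℝ (act A.transpose x) y = inner ℝ x (act A y) := by
  simp [act, inner_coord, Matrix.toLpLin_apply, Matrix.mulVec, dotProduct, Fin.sum_univ_three]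
  ring

lemma S_transpose (x : E3) : (S x).transpose = -S x := by
  ext i j; fin_cases i <;> fin_cases j <;> simp [S]

lemma cross_self (x : E3) : cross x x = 0 := by
  apply ext3 <;> simp <;> ring

lemma cross_anticomm (x y : E3) : cross x y = -cross y x := by
  apply ext3 <;> simp <;> ring

lemma cross_add_left (x y z : E3) : cross (x + y) z = cross x z + cross y z := by
  apply ext3 <;> simp <;> ring

lemma cross_add_right (x y z : E3) : cross x (y + z) = cross x y + cross x z := by
  apply ext3 <;> simp <;> ring

lemma cross_sub_left (x y z : E3) : cross (x - y) z = cross x z - cross y z := by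
  apply ext3 <;> simp <;> ring

lemma cross_smul_left (c : ℝ) (x y : E3) : cross (c • x) y = c • cross x y := by
  apply ext3 <;> simp <;> ring

lemma cross_smul_right (c : ℝ) (x y : E3) : cross x (c • y) = c • cross x y := by
  apply ext3 <;> simp <;> ring

lemma cross_cross (x y z : E3) : cross x (cross y z) = inner ℝ x z • y - inner ℝ x y • z := by
  apply ext3 <;> simp [inner_coord] <;> ring

lemma norm_cross_le (x y : E3) : ‖cross x y‖ ≤ ‖x‖ * ‖y‖ := by
  apply le_of_sq_le_sq _ (by positivity)
  rw [mul_pow, norm_sq_coord, norm_sq_coord, norm_sq_coord]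
  simp only [cross_apply_zero, cross_apply_one, cross_apply_two]
  nlinarith [sq_nonneg (x 0 * y 0 + x 1 * y 1 + x 2 * y 2)]

/-- The cross product as a continuous bilinear map. -/
def crossL : E3 →L[ℝ] E3 →L[ℝ] E3 :=
  LinearMap.mkContinuous₂
    (LinearMap.mk₂ ℝ cross cross_add_left cross_smul_left cross_add_right cross_smul_right) 1
    (fun x y => by simpa using norm_cross_le x y)

lemma hasDerivWithinAt_cross {a b : ℝ → E3} {a' b' : E3} {J : Set ℝ} {t : ℝ}
    (ha : HasDerivWithinAt a a' J t) (hb : HasDerivWithinAt b b' J t) :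
    HasDerivWithinAt (fun s => cross (a s) (b s)) (cross a' (b t) + cross (a t) b') J t := by
  have := crossL.hasDerivWithinAt_of_bilinear ha hb
  rw [add_comm]
  exact this

/-! ### Rotations -/

lemma act_rot (Q : ℝ × E3) (y : E3) :
    act (rot Q) y = y + (2 : ℝ) • cross Q.2 (cross Q.2 y) - (2 * Q.1) • cross Q.2 y := by
  rw [rot, act_sub, act_add, act_smul, act_smul, act_one, act_S_sq, act_S]

lemma rot_transpose (Q : ℝ × E3) : (rot Q).transpose = rot (qinv Q) := by
  have hS : S (-Q.2) = -S Q.2 := by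
    ext i j; fin_cases i <;> fin_cases j <;> simp [S]
  simp [rot, qinv, S_transpose, hS, Matrix.transpose_pow]

lemma act_rot_transpose (Q : ℝ × E3) (y : E3) :
    act (rot Q).transpose y
      = y + (2 : ℝ) • cross Q.2 (cross Q.2 y) + (2 * Q.1) • cross Q.2 y := by
  rw [rot_transpose, act_rot]
  apply ext3 <;> simp [qinv] <;> ring

lemma IsUnitQuat.coord {Q : ℝ × E3} (hQ : IsUnitQuat Q) :
    Q.1 ^ 2 + (Q.2 0 ^ 2 + Q.2 1 ^ 2 + Q.2 2 ^ 2) = 1 := by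
  rw [← norm_sq_coord]; exact hQ

lemma IsUnitQuat.qinv {Q : ℝ × E3} (hQ : IsUnitQuat Q) : IsUnitQuat (qinv Q) := by
  simpa [IsUnitQuat, VTOL.qinv] using hQ

lemma IsUnitQuat.qmul {Q₁ Q₂ : ℝ × E3} (h₁ : IsUnitQuat Q₁) (h₂ : IsUnitQuat Q₂) :
    IsUnitQuat (qmul Q₁ Q₂) := by
  have h₁ := h₁.coord
  have h₂ := h₂.coord
  simp only [IsUnitQuat, VTOL.qmul, norm_sq_coord, inner_coord, act_S]
  simp only [PiLp.add_apply, PiLp.smul_apply, smul_eq_mul, cross_apply_zero, cross_apply_one,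
    cross_apply_two]
  linear_combination (Q₂.1 ^ 2 + (Q₂.2 0 ^ 2 + Q₂.2 1 ^ 2 + Q₂.2 2 ^ 2)) * h₁ + h₂

/-- The homogeneous form of a rotation by a unit quaternion. -/
lemma act_rot_unit {Q : ℝ × E3} (hQ : IsUnitQuat Q) (y : E3) :
    act (rot Q) y = (Q.1 ^ 2 - ‖Q.2‖ ^ 2) • y + (2 * inner ℝ Q.2 y) • Q.2
      - (2 * Q.1) • cross Q.2 y := by
  have h₁ : Q.1 ^ 2 = 1 - ‖Q.2‖ ^ 2 := by linarith [show Q.1 ^ 2 + ‖Q.2‖ ^ 2 = 1 from hQ]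
  rw [act_rot, cross_cross, real_inner_self_eq_norm_sq, h₁]
  module

/-- The sign of the linear term in `rot` makes it reverse products, hence `R̃ = R_dᵀ R`. In
homogeneous form both sides are equal as polynomials. -/
lemma act_rot_qmul {Q₁ Q₂ : ℝ × E3} (h₁ : IsUnitQuat Q₁) (h₂ : IsUnitQuat Q₂) (y : E3) :
    act (rot (qmul Q₁ Q₂)) y = act (rot Q₂) (act (rot Q₁) y) := by
  rw [act_rot_unit (h₁.qmul h₂), act_rot_unit h₂, act_rot_unit h₁]
  apply ext3 <;>
  · simp only [VTOL.qmul, act_S, norm_sq_coord, inner_coord, PiLp.add_apply, PiLp.sub_apply,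
      PiLp.smul_apply, smul_eq_mul, cross_apply_zero, cross_apply_one, cross_apply_two]
    ring

lemma qmul_qinv {Q : ℝ × E3} (hQ : IsUnitQuat Q) : qmul Q (qinv Q) = (1, 0) := by
  have h := hQ.coord
  refine Prod.ext ?_ (ext3 ?_ ?_ ?_) <;>
    simp [VTOL.qmul, VTOL.qinv, act_S, norm_sq_coord] <;> first | ring1 | linear_combination h

lemma qinv_qinv (Q : ℝ × E3) : qinv (qinv Q) = Q := by simp [qinv]

lemma rot_transpose_rot {Q : ℝ × E3} (hQ : IsUnitQuat Q) (y : E3) :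
    act (rot Q).transpose (act (rot Q) y) = y := by
  rw [rot_transpose, ← act_rot_qmul hQ hQ.qinv, qmul_qinv hQ, act_rot]
  apply ext3 <;> simp

lemma rot_rot_transpose {Q : ℝ × E3} (hQ : IsUnitQuat Q) (y : E3) :
    act (rot Q) (act (rot Q).transpose y) = y := by
  have := rot_transpose_rot hQ.qinv y
  rwa [rot_transpose, qinv_qinv, ← rot_transpose] at this

lemma norm_rot {Q : ℝ × E3} (hQ : IsUnitQuat Q) (y : E3) : ‖act (rot Q) y‖ = ‖y‖ := by
  rw [← sq_eq_sq₀ (norm_nonneg _) (norm_nonneg _), ← real_inner_self_eq_norm_sq,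
    ← inner_act_transpose, rot_transpose_rot hQ, real_inner_self_eq_norm_sq]

lemma norm_rot_transpose {Q : ℝ × E3} (hQ : IsUnitQuat Q) (y : E3) :
    ‖act (rot Q).transpose y‖ = ‖y‖ := by
  rw [rot_transpose, norm_rot hQ.qinv]

lemma rot_cross {Q : ℝ × E3} (hQ : IsUnitQuat Q) (x y : E3) :
    act (rot Q) (cross x y) = cross (act (rot Q) x) (act (rot Q) y) := by
  -- A factor `η² + ‖q‖² = 1` gives both sides the same degree in `Q`, so that the identity becomes
  -- polynomial.
  have h' : act (rot Q) (cross x y)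
      = (Q.1 ^ 2 + ‖Q.2‖ ^ 2) • act (rot Q) (cross x y) := by
    rw [show Q.1 ^ 2 + ‖Q.2‖ ^ 2 = 1 from hQ, one_smul]
  rw [h', act_rot_unit hQ, act_rot_unit hQ, act_rot_unit hQ]
  apply ext3 <;>
  · simp only [norm_sq_coord, inner_coord, PiLp.add_apply, PiLp.sub_apply,
      PiLp.smul_apply, smul_eq_mul, cross_apply_zero, cross_apply_one, cross_apply_two]
    ring

/-- In fact `‖y - R y‖ = 2 ‖q × y‖`. This makes every effect of the attitude error linear in `‖q̃‖`.
-/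
lemma norm_sub_rot_le {Q : ℝ × E3} (hQ : IsUnitQuat Q) (y : E3) :
    ‖y - act (rot Q) y‖ ≤ 2 * ‖Q.2‖ * ‖y‖ := by
  have hs : ‖y - act (rot Q) y‖ ^ 2 = 4 * ‖cross Q.2 y‖ ^ 2 := by
    have h := hQ.coord
    rw [act_rot]
    simp only [norm_sq_coord, PiLp.add_apply, PiLp.sub_apply,
      PiLp.smul_apply, smul_eq_mul, cross_apply_zero, cross_apply_one, cross_apply_two]
    linear_combination 4 * ((Q.2 1 * y 2 - Q.2 2 * y 1) ^ 2 + (Q.2 2 * y 0 - Q.2 0 * y 2) ^ 2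
      + (Q.2 0 * y 1 - Q.2 1 * y 0) ^ 2) * h
  have hc := norm_cross_le Q.2 y
  have : ‖y - act (rot Q) y‖ = 2 * ‖cross Q.2 y‖ := by
    rw [← sq_eq_sq₀ (norm_nonneg _) (by positivity), hs]; ring
  rw [this]; linarith

/-! ### The saturation `h` and its Jacobian -/

lemma sqrt_one_add_pos (u : E3) : 0 < Real.sqrt (1 + ‖u‖ ^ 2) :=
  Real.sqrt_pos.2 (by positivity)

lemma norm_le_sqrt_one_add (u : E3) : ‖u‖ ≤ Real.sqrt (1 + ‖u‖ ^ 2) :=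
  Real.le_sqrt_of_sq_le (by linarith)

lemma norm_h_le_one (u : E3) : ‖h u‖ ≤ 1 := by
  rw [h, norm_smul, norm_inv, Real.norm_of_nonneg (sqrt_one_add_pos u).le,
    inv_mul_le_iff₀ (sqrt_one_add_pos u), mul_one]
  exact norm_le_sqrt_one_add u

lemma norm_h_le (u : E3) : ‖h u‖ ≤ ‖u‖ := by
  rw [h, norm_smul, norm_inv, Real.norm_of_nonneg (sqrt_one_add_pos u).le,
    inv_mul_le_iff₀ (sqrt_one_add_pos u)]
  have : 1 ≤ Real.sqrt (1 + ‖u‖ ^ 2) := Real.one_le_sqrt.2 (by nlinarith [norm_nonneg u])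
  nlinarith [norm_nonneg u]

lemma inner_self_h (u : E3) : inner ℝ u (h u) = ‖u‖ ^ 2 / Real.sqrt (1 + ‖u‖ ^ 2) := by
  rw [h, inner_smul_right, real_inner_self_eq_norm_sq]; ring

lemma act_phi (u y : E3) :
    act (phi u) y = ((Real.sqrt (1 + ‖u‖ ^ 2)) ^ 3)⁻¹ • (y - cross u (cross u y)) := by
  rw [phi, act_smul, act_sub, act_one, act_S_sq]

/-- With `r = √(1 + ‖u‖²) ≥ 1`, the matrix `I - S(u)²` has norm at most `r²`, and the prefactor is
`r⁻³`. -/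
lemma norm_phi_le (u y : E3) : ‖act (phi u) y‖ ≤ ‖y‖ := by
  have hr := sqrt_one_add_pos u
  have hr2 : Real.sqrt (1 + ‖u‖ ^ 2) ^ 2 = 1 + ‖u‖ ^ 2 := Real.sq_sqrt (by positivity)
  have hr1 : 1 ≤ Real.sqrt (1 + ‖u‖ ^ 2) := Real.one_le_sqrt.2 (by nlinarith [norm_nonneg u])
  rw [act_phi, norm_smul, norm_inv, norm_pow, Real.norm_of_nonneg hr.le,
    inv_mul_le_iff₀ (by positivity)]
  have h1 : ‖cross u (cross u y)‖ ≤ ‖u‖ * (‖u‖ * ‖y‖) :=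
    (norm_cross_le _ _).trans (by gcongr; exact norm_cross_le _ _)
  calc ‖y - cross u (cross u y)‖ ≤ ‖y‖ + ‖u‖ * (‖u‖ * ‖y‖) := (norm_sub_le _ _).trans (by gcongr)
    _ = Real.sqrt (1 + ‖u‖ ^ 2) ^ 2 * ‖y‖ := by rw [hr2]; ring
    _ ≤ Real.sqrt (1 + ‖u‖ ^ 2) ^ 3 * ‖y‖ := by gcongr; norm_num

/-- `h` is the gradient of `√(1 + ‖u‖²)`, which is why this root serves as the potential in
`energy`. -/
lemma hasDerivWithinAt_sqrt_one_add {u : ℝ → E3} {u' : E3} {J : Set ℝ} {t : ℝ}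
    (hu : HasDerivWithinAt u u' J t) :
    HasDerivWithinAt (fun s => Real.sqrt (1 + ‖u s‖ ^ 2)) (inner ℝ (h (u t)) u') J t := by
  have h1 := (hu.norm_sq.const_add 1).sqrt (by positivity)
  convert h1 using 1
  rw [h, real_inner_smul_left]
  field_simp

lemma hasDerivWithinAt_h {u : ℝ → E3} {u' : E3} {J : Set ℝ} {t : ℝ}
    (hu : HasDerivWithinAt u u' J t) :
    HasDerivWithinAt (fun s => h (u s)) (act (phi (u t)) u') J t := by
  have hr := sqrt_one_add_pos (u t)
  have hr2 : Real.sqrt (1 + ‖u t‖ ^ 2) ^ 2 = 1 + ‖u t‖ ^ 2 := Real.sq_sqrt (by positivity)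
  have h1 : HasDerivWithinAt (fun s => h (u s)) ((Real.sqrt (1 + ‖u t‖ ^ 2))⁻¹ • u'
      + (-inner ℝ (h (u t)) u' / Real.sqrt (1 + ‖u t‖ ^ 2) ^ 2) • u t) J t :=
    ((hasDerivWithinAt_sqrt_one_add hu).inv hr.ne').smul hu
  refine h1.congr_deriv ?_
  rw [act_phi, cross_cross, real_inner_self_eq_norm_sq, h, real_inner_smul_left]
  have e1 : ‖u t‖ ^ 2 = Real.sqrt (1 + ‖u t‖ ^ 2) ^ 2 - 1 := by linarith
  clear h1 hr2
  generalize Real.sqrt (1 + ‖u t‖ ^ 2) = r at *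
  rw [e1]
  match_scalars <;> simp <;> field_simp

/-! ### Thrust and attitude extraction -/

lemma le_thrust (g : ℝ) (hg : 0 ≤ g) (μ : E3) : g - ‖μ‖ ≤ thrust g μ := by
  have := norm_sub_norm_le (g • e3) μ
  rw [norm_sub_rev, norm_smul, norm_e3, mul_one, Real.norm_of_nonneg hg] at this
  exact this

lemma thrust_le (g : ℝ) (hg : 0 ≤ g) (μ : E3) : thrust g μ ≤ g + ‖μ‖ := by
  have := norm_sub_le μ (g • e3)
  rw [norm_smul, norm_e3, mul_one, Real.norm_of_nonneg hg, add_comm] at this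
  exact this

lemma thrust_pos {g : ℝ} {μ : E3} (hμ : ‖μ‖ < g) : 0 < thrust g μ := by
  have := le_thrust g ((norm_nonneg μ).trans hμ.le) μ
  linarith

lemma thrust_sq (g : ℝ) (μ : E3) : thrust g μ ^ 2 = μ 0 ^ 2 + μ 1 ^ 2 + (g - μ 2) ^ 2 := by
  rw [thrust, norm_sq_coord]; simp; ring

lemma sub_apply_two_pos {g : ℝ} {μ : E3} (hμ : ‖μ‖ < g) : 0 < g - μ 2 := by
  linarith [le_abs_self (μ 2), abs_coord_le μ 2]

lemma etaD_arg (g : ℝ) (μ : E3) :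
    1 / 2 * (1 + (g - inner ℝ e3 μ) / ‖μ - g • e3‖) = 1 / 2 * (1 + (g - μ 2) / thrust g μ) := by
  rw [inner_coord, thrust]; simp

lemma etaD_sq {g : ℝ} {μ : E3} (hμ : ‖μ‖ < g) :
    etaD g μ ^ 2 = 1 / 2 * (1 + (g - μ 2) / thrust g μ) := by
  have := thrust_pos hμ
  have := sub_apply_two_pos hμ
  rw [etaD, etaD_arg, Real.sq_sqrt (by positivity)]

lemma etaD_pos {g : ℝ} {μ : E3} (hμ : ‖μ‖ < g) : 0 < etaD g μ := by
  have := thrust_pos hμ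
  have := sub_apply_two_pos hμ
  rw [etaD, etaD_arg]
  exact Real.sqrt_pos.2 (by positivity)

/-- The relation between `η_d` and the thrust, free of denominators. -/
lemma two_etaD_sq_mul_thrust {g : ℝ} {μ : E3} (hμ : ‖μ‖ < g) :
    g - μ 2 = 2 * etaD g μ ^ 2 * thrust g μ - thrust g μ := by
  have := (thrust_pos hμ).ne'
  rw [etaD_sq hμ]; field_simp; ring

/-- `‖μ‖ < g` keeps `g - μ₃` positive; division by `η_d` is therefore harmless. -/
lemma half_le_etaD_sq {g : ℝ} {μ : E3} (hμ : ‖μ‖ < g) : 1 / 2 ≤ etaD g μ ^ 2 := by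
  have := thrust_pos hμ
  have := sub_apply_two_pos hμ
  rw [etaD_sq hμ]
  have : 0 ≤ (g - μ 2) / thrust g μ := by positivity
  linarith

lemma etaD_sq_le_one {g : ℝ} {μ : E3} (hμ : ‖μ‖ < g) : etaD g μ ^ 2 ≤ 1 := by
  have h1 := thrust_pos hμ
  rw [etaD_sq hμ]
  have : (g - μ 2) / thrust g μ ≤ 1 := by
    rw [div_le_one h1]
    apply le_of_sq_le_sq _ h1.le
    rw [thrust_sq]
    nlinarith [sq_nonneg (μ 0), sq_nonneg (μ 1)]
  linarith

/-- The horizontal part of `μ`, in terms of the thrust and `η_d`. -/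
lemma horizontal_sq {g : ℝ} {μ : E3} (hμ : ‖μ‖ < g) :
    μ 0 ^ 2 + μ 1 ^ 2 = 4 * etaD g μ ^ 2 * thrust g μ ^ 2 * (1 - etaD g μ ^ 2) := by
  have h1 := thrust_sq g μ
  rw [two_etaD_sq_mul_thrust hμ] at h1
  linear_combination -h1

lemma attD_snd (g : ℝ) (μ : E3) :
    (attD g μ).2 = (1 / (2 * thrust g μ * etaD g μ)) • cross μ e3 := by
  rw [attD, act_S, thrust]

lemma isUnitQuat_attD {g : ℝ} {μ : E3} (hμ : ‖μ‖ < g) : IsUnitQuat (attD g μ) := by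
  have h1 := horizontal_sq hμ
  have hu := (thrust_pos hμ).ne'
  have he := (etaD_pos hμ).ne'
  rw [IsUnitQuat, attD_snd, norm_smul, mul_pow, norm_sq_coord]
  simp only [cross_apply_zero, cross_apply_one, cross_apply_two, e3_apply_zero, e3_apply_one,
    e3_apply_two, Real.norm_eq_abs, sq_abs]
  have : (attD g μ).1 = etaD g μ := rfl
  rw [this]
  field_simp
  linear_combination h1

/-- The purpose of the extraction: at attitude `Q_d`, gravity plus thrust is exactly `μ`. -/
lemma thrust_smul_rot_attD {g : ℝ} {μ : E3} (hμ : ‖μ‖ < g) :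
    thrust g μ • act (rot (attD g μ)).transpose e3 = g • e3 - μ := by
  have h1 := horizontal_sq hμ
  have h2 := two_etaD_sq_mul_thrust hμ
  have hu := (thrust_pos hμ).ne'
  have he := (etaD_pos hμ).ne'
  have h0 : (attD g μ).1 = etaD g μ := rfl
  rw [act_rot_transpose, attD_snd, h0]
  apply ext3
  · simp; field_simp
  · simp; field_simp
  · simp
    rw [h2]
    field_simp
    linear_combination (-1) * h1

lemma act_M (g : ℝ) (μ x : E3) :
    act (M g μ) x = (1 / (4 * etaD g μ ^ 2 * thrust g μ ^ 4)) •
      (-(4 * cross (μ - g • e3) (cross (μ - g • e3) x) 2) • cross μ e3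
        + (4 * etaD g μ ^ 2 * thrust g μ) •
            cross e3 (cross (μ - g • e3) (cross (μ - g • e3) x))
        + (2 : ℝ) • cross μ (cross (μ - g • e3) (cross (μ - g • e3) x))
        - (2 * μ 2) • cross e3 (cross (μ - g • e3) (cross (μ - g • e3) x))) := by
  rw [M, act_smul, act_mul, act_S_sq, act_sub, act_add, act_add, act_smul, act_smul, act_smul,
    act_smul, act_mul, act_vecMulVec, act_S, act_S, act_S]
  congr 1
  generalize cross (μ - g • e3) (cross (μ - g • e3) x) = w
  apply ext3 <;> simp [inner_coord] <;> ring

/-- The factor `S(μ - g e₃)²` contributes `u²`, the bracket `O(u + ‖μ‖)`, and the prefactor at most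
`1/(2u⁴)` because `η_d² ≥ 1/2`. What is left is `O(u⁻²)` with `u ≥ g - k`. -/
lemma norm_M_le {g k : ℝ} {μ : E3} (hμ : ‖μ‖ ≤ k) (hk : k < g) (x : E3) :
    ‖act (M g μ) x‖ ≤ (4 * k + 2 * (g + k)) / (g - k) ^ 2 * ‖x‖ := by
  have hμg : ‖μ‖ < g := hμ.trans_lt hk
  have hg : 0 ≤ g := (norm_nonneg μ).trans hμg.le
  have hu := thrust_pos hμg
  have hu1 := le_thrust g hg μ
  have hu2 := thrust_le g hg μ
  have he := etaD_sq_le_one hμg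
  have he2 := half_le_etaD_sq hμg
  have h2 := abs_coord_le μ 2
  rw [act_M]
  have hw : ‖cross (μ - g • e3) (cross (μ - g • e3) x)‖ ≤ thrust g μ ^ 2 * ‖x‖ := by
    refine (norm_cross_le _ _).trans ?_
    rw [pow_two, mul_assoc]
    exact mul_le_mul_of_nonneg_left (norm_cross_le _ _) (norm_nonneg _)
  generalize cross (μ - g • e3) (cross (μ - g • e3) x) = w at *
  have hw2 := abs_coord_le w 2
  have a1 : ‖-(4 * w 2) • cross μ e3‖ ≤ 4 * ‖w‖ * ‖μ‖ := by
    rw [norm_smul, Real.norm_eq_abs, abs_neg, abs_mul, abs_of_pos (by norm_num : (0:ℝ) < 4)]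
    have := norm_cross_le μ e3
    rw [norm_e3, mul_one] at this
    gcongr
  have he3 : ‖cross e3 w‖ ≤ ‖w‖ := by
    have := norm_cross_le e3 w
    rwa [norm_e3, one_mul] at this
  have a2 : ‖(4 * etaD g μ ^ 2 * thrust g μ) • cross e3 w‖ ≤ 4 * 1 * thrust g μ * ‖w‖ := by
    rw [norm_smul, Real.norm_of_nonneg (by positivity)]
    gcongr
  have a3 : ‖(2 : ℝ) • cross μ w‖ ≤ 2 * (‖μ‖ * ‖w‖) := by
    rw [norm_smul, Real.norm_of_nonneg (by positivity)]
    gcongr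
    exact norm_cross_le _ _
  have a4 : ‖(2 * μ 2) • cross e3 w‖ ≤ 2 * ‖μ‖ * ‖w‖ := by
    rw [norm_smul, Real.norm_eq_abs, abs_mul, abs_of_pos (by norm_num : (0:ℝ) < 2)]
    gcongr
  have hk0 : 0 ≤ k := (norm_nonneg μ).trans hμ
  rw [norm_smul, Real.norm_of_nonneg (by positivity)]
  have hb : ‖-(4 * w 2) • cross μ e3 + (4 * etaD g μ ^ 2 * thrust g μ) • cross e3 w
      + (2 : ℝ) • cross μ w - (2 * μ 2) • cross e3 w‖
      ≤ (8 * k + 4 * (g + k)) * (thrust g μ ^ 2 * ‖x‖) := by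
    refine (norm_sub_le _ _).trans ?_
    refine (add_le_add (norm_add₃_le) le_rfl).trans ?_
    calc _ ≤ (8 * ‖μ‖ + 4 * thrust g μ) * ‖w‖ := by linarith
      _ ≤ (8 * k + 4 * (g + k)) * (thrust g μ ^ 2 * ‖x‖) := by
        gcongr; linarith
  have hc : 1 / (4 * etaD g μ ^ 2 * thrust g μ ^ 4) ≤ 1 / (2 * thrust g μ ^ 4) := by
    apply one_div_le_one_div_of_le (by positivity)
    have : 0 ≤ thrust g μ ^ 4 := by positivity
    nlinarith
  calc _ ≤ 1 / (2 * thrust g μ ^ 4) * ((8 * k + 4 * (g + k)) * (thrust g μ ^ 2 * ‖x‖)) := by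
        gcongr
    _ = (4 * k + 2 * (g + k)) / thrust g μ ^ 2 * ‖x‖ := by field_simp; ring
    _ ≤ _ := by
      gcongr
      linarith

lemma hasDerivWithinAt_thrust {g : ℝ} {μ : ℝ → E3} {μ' : E3} {J : Set ℝ} {t : ℝ}
    (hμ : HasDerivWithinAt μ μ' J t) (hμg : ‖μ t‖ < g) :
    HasDerivWithinAt (fun s => thrust g (μ s))
      (inner ℝ (μ t - g • e3) μ' / thrust g (μ t)) J t := by
  have hu := thrust_pos hμg
  have h1 := (hμ.sub_const (g • e3)).norm_sq.sqrt (by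
    have : 0 < ‖μ t - g • e3‖ := hu
    positivity)
  simp only [Real.sqrt_sq (norm_nonneg _)] at h1
  refine h1.congr_deriv ?_
  simp only [thrust]; field_simp

lemma abs_thrustRate_le {g : ℝ} {μ : E3} (hμ : ‖μ‖ < g) (y : E3) :
    |inner ℝ (μ - g • e3) y / thrust g μ| ≤ ‖y‖ := by
  have hu := thrust_pos hμ
  rw [abs_div, abs_of_pos hu, div_le_iff₀ hu, mul_comm]
  exact abs_real_inner_le_norm _ _

lemma hasDerivWithinAt_coord {μ : ℝ → E3} {μ' : E3} {J : Set ℝ} {t : ℝ}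
    (hμ : HasDerivWithinAt μ μ' J t) (i : Fin 3) :
    HasDerivWithinAt (fun s => μ s i) (μ' i) J t :=
  (EuclideanSpace.proj (𝕜 := ℝ) i).hasFDerivAt.comp_hasDerivWithinAt t hμ

/-- The derivative of the desired attitude: `M(μ) μ'` is the desired angular velocity. -/
lemma hasDerivWithinAt_attD {g : ℝ} {μ : ℝ → E3} {μ' : E3} {J : Set ℝ} {t : ℝ}
    (hμ : HasDerivWithinAt μ μ' J t) (hμg : ‖μ t‖ < g) :
    HasDerivWithinAt (fun s => attD g (μ s))
      (quatRate (attD g (μ t)) (act (M g (μ t)) μ')) J t := by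
  have hu := thrust_pos hμg
  have he := etaD_pos hμg
  have hs := two_etaD_sq_mul_thrust hμg
  have hh := horizontal_sq hμg
  have du := hasDerivWithinAt_thrust hμ hμg
  have hD : inner ℝ (μ t - g • e3) μ'
      = μ t 0 * μ' 0 + μ t 1 * μ' 1 - (g - μ t 2) * μ' 2 := by
    rw [inner_coord]; simp; ring
  have dη : HasDerivWithinAt (fun s => etaD g (μ s))
      ((-μ' 2 * thrust g (μ t) ^ 2 - (g - μ t 2) * inner ℝ (μ t - g • e3) μ')
        / (4 * etaD g (μ t) * thrust g (μ t) ^ 3)) J t := by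
    have e1 : (fun s => etaD g (μ s))
        = fun s => Real.sqrt (1 / 2 * (1 + (g - μ s 2) / thrust g (μ s))) := by
      funext s; rw [etaD, etaD_arg]
    have e2 := congrFun e1 t
    have d1 : HasDerivWithinAt (fun s => (g - μ s 2) / thrust g (μ s)) _ J t :=
      ((hasDerivWithinAt_coord hμ 2).const_sub g).div du hu.ne'
    have h1 := ((d1.const_add 1).const_mul (1 / 2)).sqrt (by
      rw [← etaD_sq hμg]; positivity)
    rw [e1]
    refine h1.congr_deriv ?_
    rw [← e2]
    field_simp
    ring
  have d1 : HasDerivWithinAt (fun s => 2 * thrust g (μ s) * etaD g (μ s)) _ J t :=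
    (du.const_mul 2).mul dη
  have d2 : HasDerivWithinAt (fun s => (2 * thrust g (μ s) * etaD g (μ s))⁻¹) _ J t :=
    d1.inv (by positivity)
  have d3 : HasDerivWithinAt
      (fun s => (2 * thrust g (μ s) * etaD g (μ s))⁻¹ • cross (μ s) e3) _ J t :=
    d2.smul (hasDerivWithinAt_cross hμ (hasDerivWithinAt_const t J e3))
  have e1 : (fun s => attD g (μ s))
      = fun s => (etaD g (μ s), (2 * thrust g (μ s) * etaD g (μ s))⁻¹ • cross (μ s) e3) := by
    funext s
    rw [← one_div, ← attD_snd]; rfl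
  rw [e1]
  refine (dη.prodMk d3).congr_deriv ?_
  rw [act_M]
  have h0 : (attD g (μ t)).1 = etaD g (μ t) := rfl
  rw [hD]
  simp only [quatRate, attD_snd, act_S, h0]
  -- Eliminating `μ₃` leaves `u`, `η` and the horizontal part of `μ`, tied by the single relation
  -- `hh`. The coefficients below are its polynomial multipliers; the last component needs none.
  have h2 : μ t 2 = g - (2 * etaD g (μ t) ^ 2 * thrust g (μ t) - thrust g (μ t)) := by
    linarith
  clear e1 d3 d2 d1 dη du hD h0 hs hμ hμg
  generalize thrust g (μ t) = u at *
  generalize etaD g (μ t) = η at *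
  have hu0 := hu.ne'
  have he0 := he.ne'
  refine Prod.ext ?_ (ext3 ?_ ?_ ?_)
  · simp [inner_coord]
    rw [h2]
    clear h2
    generalize (μ t) 0 = a at *
    generalize (μ t) 1 = b at *
    generalize μ' 0 = a' at *
    generalize μ' 1 = b' at *
    generalize μ' 2 = c' at *
    field_simp
    linear_combination (2 * b ^ 2 * c' + 4 * b * b' * u * η ^ 2 + 4 * a * a' * u * η ^ 2 - 2 * a * a' * u
      + 2 * a ^ 2 * c' - 2 * b * b' * u + 4 * c' * u ^ 2 * η ^ 2) * hh
  · simp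
    rw [h2]
    clear h2
    generalize (μ t) 0 = a at *
    generalize (μ t) 1 = b at *
    generalize μ' 0 = a' at *
    generalize μ' 1 = b' at *
    generalize μ' 2 = c' at *
    field_simp
    linear_combination (a * b * a' - 2 * b * c' * u * η ^ 2 - 4 * b' * u ^ 2 * η ^ 4 - b' * u ^ 2 - a ^ 2 * b') * hh
  · simp
    rw [h2]
    clear h2
    generalize (μ t) 0 = a at *
    generalize (μ t) 1 = b at *
    generalize μ' 0 = a' at *
    generalize μ' 1 = b' at *
    generalize μ' 2 = c' at *
    field_simp
    linear_combination (a' * u ^ 2 + 4 * a' * u ^ 2 * η ^ 4 + 2 * a * c' * u * η ^ 2 - a * b * b' + b ^ 2 * a') * hh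
  · simp
    rw [h2]
    clear h2
    generalize (μ t) 0 = a at *
    generalize (μ t) 1 = b at *
    generalize μ' 0 = a' at *
    generalize μ' 1 = b' at *
    generalize μ' 2 = c' at *
    field_simp
    ring

/-! ### Attitude kinematics -/

lemma hasDerivWithinAt_rot {Q : ℝ → ℝ × E3} {y : ℝ → E3} {ω y' : E3} {J : Set ℝ} {t : ℝ}
    (hQ : HasDerivWithinAt Q (quatRate (Q t) ω) J t) (hy : HasDerivWithinAt y y' J t)
    (hu : IsUnitQuat (Q t)) :
    HasDerivWithinAt (fun s => act (rot (Q s)) (y s))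
      (act (rot (Q t)) y' - cross ω (act (rot (Q t)) (y t))) J t := by
  have h1 : HasDerivWithinAt (fun s => (Q s).1) (quatRate (Q t) ω).1 J t :=
    (ContinuousLinearMap.fst ℝ ℝ E3).hasFDerivAt.comp_hasDerivWithinAt t hQ
  have h2 : HasDerivWithinAt (fun s => (Q s).2) (quatRate (Q t) ω).2 J t :=
    (ContinuousLinearMap.snd ℝ ℝ E3).hasFDerivAt.comp_hasDerivWithinAt t hQ
  have h3 := hasDerivWithinAt_cross h2 hy
  have h4 := hasDerivWithinAt_cross h2 h3
  simp only [act_rot]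
  refine ((hy.add (h4.const_smul (2 : ℝ))).sub ((h1.const_mul 2).smul h3)).congr_deriv ?_
  rw [← act_rot, ← act_rot, act_rot_unit hu (y t), act_rot, quatRate]
  apply ext3 <;>
  · simp only [act_S, norm_sq_coord, inner_coord, PiLp.add_apply, PiLp.sub_apply,
      PiLp.smul_apply, smul_eq_mul, cross_apply_zero, cross_apply_one, cross_apply_two]
    ring

lemma hasDerivWithinAt_rot_transpose {Q : ℝ → ℝ × E3} {y : ℝ → E3} {ω y' : E3} {J : Set ℝ}
    {t : ℝ} (hQ : HasDerivWithinAt Q (quatRate (Q t) ω) J t) (hy : HasDerivWithinAt y y' J t)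
    (hu : IsUnitQuat (Q t)) :
    HasDerivWithinAt (fun s => act (rot (Q s)).transpose (y s))
      (act (rot (Q t)).transpose (y' + cross ω (y t))) J t := by
  have h1 : HasDerivWithinAt (fun s => (Q s).1) (quatRate (Q t) ω).1 J t :=
    (ContinuousLinearMap.fst ℝ ℝ E3).hasFDerivAt.comp_hasDerivWithinAt t hQ
  have h2 : HasDerivWithinAt (fun s => (Q s).2) (quatRate (Q t) ω).2 J t :=
    (ContinuousLinearMap.snd ℝ ℝ E3).hasFDerivAt.comp_hasDerivWithinAt t hQ
  have h3 := hasDerivWithinAt_cross h2 hy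
  have h4 := hasDerivWithinAt_cross h2 h3
  simp only [act_rot_transpose]
  refine ((hy.add (h4.const_smul (2 : ℝ))).add ((h1.const_mul 2).smul h3)).congr_deriv ?_
  rw [← act_rot_transpose, act_add_right, rot_transpose, act_rot_unit hu.qinv (cross ω (y t)),
    ← rot_transpose, act_rot_transpose, quatRate, qinv]
  apply ext3 <;>
  · simp only [act_S, norm_sq_coord, inner_coord, PiLp.add_apply, PiLp.sub_apply, PiLp.neg_apply,
      PiLp.smul_apply, smul_eq_mul, cross_apply_zero, cross_apply_one, cross_apply_two]
    ring

/-- Only the mismatch `ω - ω_d` drives the error, seen in the frame turned by `R_dᵀ`. Moving `R_d`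
onto `q̃` reduces the claim to the product rule. -/
lemma hasDerivWithinAt_qmul_qinv_fst {Q Qd : ℝ → ℝ × E3} {ω ωd : E3} {J : Set ℝ} {t : ℝ}
    (hQ : HasDerivWithinAt Q (quatRate (Q t) ω) J t)
    (hQd : HasDerivWithinAt Qd (quatRate (Qd t) ωd) J t) (hu : IsUnitQuat (Qd t)) :
    HasDerivWithinAt (fun s => (qmul (Q s) (qinv (Qd s))).1)
      (-(1 / 2) * inner ℝ (qmul (Q t) (qinv (Qd t))).2
        (act (rot (Qd t)).transpose (ω - ωd))) J t := by
  have h1 : HasDerivWithinAt (fun s => (Q s).1) (quatRate (Q t) ω).1 J t :=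
    (ContinuousLinearMap.fst ℝ ℝ E3).hasFDerivAt.comp_hasDerivWithinAt t hQ
  have h2 : HasDerivWithinAt (fun s => (Q s).2) (quatRate (Q t) ω).2 J t :=
    (ContinuousLinearMap.snd ℝ ℝ E3).hasFDerivAt.comp_hasDerivWithinAt t hQ
  have h3 : HasDerivWithinAt (fun s => (Qd s).1) (quatRate (Qd t) ωd).1 J t :=
    (ContinuousLinearMap.fst ℝ ℝ E3).hasFDerivAt.comp_hasDerivWithinAt t hQd
  have h4 : HasDerivWithinAt (fun s => (Qd s).2) (quatRate (Qd t) ωd).2 J t :=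
    (ContinuousLinearMap.snd ℝ ℝ E3).hasFDerivAt.comp_hasDerivWithinAt t hQd
  simp only [qmul, qinv]
  refine ((h1.mul h3).sub (h2.inner ℝ h4.fun_neg)).congr_deriv ?_
  rw [real_inner_comm (act (rot (Qd t)).transpose _), inner_act_transpose]
  have key : act (rot (Qd t)) ((Q t).1 • -(Qd t).2 + (Qd t).1 • (Q t).2
      + act (S (Q t).2) (-(Qd t).2))
      = (Qd t).1 • (Q t).2 - (Q t).1 • (Qd t).2 - cross (Qd t).2 (Q t).2 := by
    have h := hu.coord
    rw [act_rot_unit hu]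
    generalize Qd t = D at *
    generalize Q t = q at *
    apply ext3
    · simp only [act_S, norm_sq_coord, inner_coord, PiLp.add_apply, PiLp.sub_apply, PiLp.neg_apply,
        PiLp.smul_apply, smul_eq_mul, cross_apply_zero, cross_apply_one, cross_apply_two]
      linear_combination (D.1 * q.2 0 - q.1 * D.2 0 - (D.2 1 * q.2 2 - D.2 2 * q.2 1)) * h
    · simp only [act_S, norm_sq_coord, inner_coord, PiLp.add_apply, PiLp.sub_apply, PiLp.neg_apply,
        PiLp.smul_apply, smul_eq_mul, cross_apply_zero, cross_apply_one, cross_apply_two]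
      linear_combination (D.1 * q.2 1 - q.1 * D.2 1 - (D.2 2 * q.2 0 - D.2 0 * q.2 2)) * h
    · simp only [act_S, norm_sq_coord, inner_coord, PiLp.add_apply, PiLp.sub_apply, PiLp.neg_apply,
        PiLp.smul_apply, smul_eq_mul, cross_apply_zero, cross_apply_one, cross_apply_two]
      linear_combination (D.1 * q.2 2 - q.1 * D.2 2 - (D.2 0 * q.2 1 - D.2 1 * q.2 0)) * h
  rw [key]
  simp only [quatRate, act_S, inner_coord, PiLp.add_apply, PiLp.sub_apply, PiLp.neg_apply,
    PiLp.smul_apply, smul_eq_mul, cross_apply_zero, cross_apply_one, cross_apply_two]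
  ring

lemma hasDerivWithinAt_quat_norm_sq {Q : ℝ → ℝ × E3} {ω : E3} {J : Set ℝ} {t : ℝ}
    (hQ : HasDerivWithinAt Q (quatRate (Q t) ω) J t) :
    HasDerivWithinAt (fun s => (Q s).1 ^ 2 + ‖(Q s).2‖ ^ 2) 0 J t := by
  have h1 : HasDerivWithinAt (fun s => (Q s).1) (quatRate (Q t) ω).1 J t :=
    (ContinuousLinearMap.fst ℝ ℝ E3).hasFDerivAt.comp_hasDerivWithinAt t hQ
  have h2 : HasDerivWithinAt (fun s => (Q s).2) (quatRate (Q t) ω).2 J t :=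
    (ContinuousLinearMap.snd ℝ ℝ E3).hasFDerivAt.comp_hasDerivWithinAt t hQ
  refine ((h1.pow 2).add h2.norm_sq).congr_deriv ?_
  simp only [quatRate, act_S, inner_coord, PiLp.add_apply,
    PiLp.smul_apply, smul_eq_mul, cross_apply_zero, cross_apply_one, cross_apply_two]
  push_cast
  ring

/-- The quadratic form that drives the scalar part of the attitude error. -/
lemma inner_cross_rot {Q : ℝ × E3} (r : E3) :
    inner ℝ Q.2 (cross r (act (rot Q) r)) = -(2 * Q.1) * ‖cross Q.2 r‖ ^ 2 := by
  rw [act_rot]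
  simp only [norm_sq_coord, inner_coord, PiLp.add_apply, PiLp.sub_apply,
    PiLp.smul_apply, smul_eq_mul, cross_apply_zero, cross_apply_one, cross_apply_two]
  ring

/-! ### Algebra of the closed loop -/

section Algebra

variable {P : Vehicle} {K : Gains} {X : State}

/-- The rate of `μ_d` along solutions. -/
def muRate (P : Vehicle) (K : Gains) (X : State) : E3 :=
  -(K.kp • act (phi (eP P X)) X.v) - K.kv • act (phi X.v) (P.g • e3 + r2 P K X)

/-- The part of the attitude error rate that is due to the unknown apparent acceleration. -/
def xi (P : Vehicle) (K : Gains) (X : State) : E3 :=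
  act (RD P K X).transpose (act (M P.g (muD P K X))
    (K.kv • act (phi X.v) (r2 P K X - act (rot (Qerr P K X)) (r2 P K X))))

lemma norm_muD_le (hp : 0 ≤ K.kp) (hv : 0 ≤ K.kv) : ‖muD P K X‖ ≤ K.kp + K.kv := by
  rw [muD]
  refine (norm_sub_le _ _).trans ?_
  rw [norm_neg, norm_smul, norm_smul, Real.norm_of_nonneg hp, Real.norm_of_nonneg hv]
  have h1 := norm_h_le_one (eP P X)
  have h2 := norm_h_le_one X.v
  nlinarith

lemma isUnitQuat_QD (hμ : ‖muD P K X‖ < P.g) : IsUnitQuat (QD P K X) := isUnitQuat_attD hμ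

lemma isUnitQuat_Qerr (hμ : ‖muD P K X‖ < P.g) (hQ : IsUnitQuat X.Q) :
    IsUnitQuat (Qerr P K X) := hQ.qmul (isUnitQuat_QD hμ).qinv

lemma rot_Qerr (hμ : ‖muD P K X‖ < P.g) (hQ : IsUnitQuat X.Q) (y : E3) :
    act (rot (Qerr P K X)) y = act (RD P K X).transpose (act (rot X.Q) y) := by
  rw [Qerr, act_rot_qmul hQ (isUnitQuat_QD hμ).qinv, RD, rot_transpose]

lemma RD_transpose_cross (hμ : ‖muD P K X‖ < P.g) (x y : E3) :
    act (RD P K X).transpose (cross x y)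
      = cross (act (RD P K X).transpose x) (act (RD P K X).transpose y) := by
  rw [RD, rot_transpose, rot_cross (isUnitQuat_QD hμ).qinv]

lemma RD_transpose_RD (hμ : ‖muD P K X‖ < P.g) (x : E3) :
    act (RD P K X).transpose (act (RD P K X) x) = x :=
  rot_transpose_rot (isUnitQuat_QD hμ) x

lemma uT_smul_RD (hμ : ‖muD P K X‖ < P.g) :
    uT P K X • act (RD P K X).transpose e3 = P.g • e3 - muD P K X :=
  thrust_smul_rot_attD hμ

/-- Substitute `k₁ (v - v̂) = r̃₂ + r₂ - R̃r₂` and use `R_dᵀ b₂ = R̃ r₂`; the product of `R̃ r₂`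
with itself vanishes. -/
lemma RD_transpose_psi (hμ : ‖muD P K X‖ < P.g) (hQ : IsUnitQuat X.Q) :
    act (RD P K X).transpose (psi P K X)
      = K.γ₁ • cross P.r₁ (act (rot (Qerr P K X)) P.r₁)
        + K.γ₂ • cross (r2 P K X) (act (rot (Qerr P K X)) (r2 P K X))
        + K.γ₂ • cross (r2err P K X) (act (rot (Qerr P K X)) (r2 P K X)) := by
  have h1 : K.k₁ • (X.v - X.vhat)
      = r2err P K X + (r2 P K X - act (rot (Qerr P K X)) (r2 P K X)) := by
    rw [r2err, act_sub, act_one]; abel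
  rw [psi, act_S, act_S, act_add_right, act_smul_right, act_smul_right, RD_transpose_cross hμ,
    RD_transpose_cross hμ, RD_transpose_RD hμ, RD_transpose_RD hμ, b1, b2, ← rot_Qerr hμ hQ,
    ← rot_Qerr hμ hQ, mul_smul, ← cross_smul_left K.k₁, h1, cross_add_left, cross_sub_left, cross_self,
    sub_zero]
  module

/-- The input uses the computable `R_dᵀ b₂ = R̃ r₂` where the exact rate of `μ_d` has `r₂`; the
difference is the extra term. -/
lemma omega_eq (hμ : ‖muD P K X‖ < P.g) (hQ : IsUnitQuat X.Q) :
    omega P K X = act (M P.g (muD P K X)) (muRate P K X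
      + K.kv • act (phi X.v) (r2 P K X - act (rot (Qerr P K X)) (r2 P K X))) + psi P K X := by
  rw [omega]
  congr 2
  rw [act_add_right, act_smul_right, uT_smul_RD hμ, b2, ← rot_Qerr hμ hQ, fMuD, muRate]
  have h1 : K.kp • h (eP P X) + K.kv • h X.v = -muD P K X := by rw [muD]; abel
  rw [h1]
  simp only [act_add_right, act_sub_right, act_neg_right]
  module

lemma RD_transpose_omega_sub (hμ : ‖muD P K X‖ < P.g) (hQ : IsUnitQuat X.Q) :
    act (RD P K X).transpose (omega P K X - act (M P.g (muD P K X)) (muRate P K X))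
      = xi P K X + act (RD P K X).transpose (psi P K X) := by
  rw [omega_eq hμ hQ, xi, act_add_right (M P.g (muD P K X))]
  simp only [act_add_right, act_sub_right]
  abel

lemma velocity_rate (P : Vehicle) (K : Gains) (X : State) :
    P.g • e3 - uT P K X • act (rot X.Q).transpose e3 + P.δ X.v = P.g • e3 + r2 P K X := by
  rw [r2]; abel

/-- Since `R̃ Rᵀ = R_dᵀ`, splitting `Rᵀe₃` into `R̃ Rᵀe₃` and the rest isolates the desired
acceleration. -/
lemma velocity_rate_eq (hμ : ‖muD P K X‖ < P.g) (hQ : IsUnitQuat X.Q) :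
    P.g • e3 + r2 P K X = muD P K X + P.δ X.v
      - uT P K X • (act (rot X.Q).transpose e3
        - act (rot (Qerr P K X)) (act (rot X.Q).transpose e3)) := by
  rw [rot_Qerr hμ hQ, rot_rot_transpose hQ, smul_sub, uT_smul_RD hμ, r2]; abel

/-- The last term of the filter equation yields `-R̃r₂ × R_dᵀψ`, designed to cancel the contribution
of `ψ` to the rate of `R̃ r₂`. -/
lemma filter_rate (hk : K.k₁ ≠ 0) (hμ : ‖muD P K X‖ < P.g) (hQ : IsUnitQuat X.Q) :
    K.k₁ • (P.g • e3 + r2 P K X - vhatRate P K X)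
      = -(K.k₁ • r2err P K X)
        - cross (act (rot (Qerr P K X)) (r2 P K X)) (act (RD P K X).transpose (psi P K X)) := by
  rw [vhatRate, act_S, RD_transpose_cross hμ, b2, ← rot_Qerr hμ hQ, r2err, act_sub, act_one]
  match_scalars <;> field_simp; ring

end Algebra

/-! ### Rates along solutions -/

lemma uT_nonneg (P : Vehicle) (K : Gains) (X : State) : 0 ≤ uT P K X := norm_nonneg _

section Rates

variable {P : Vehicle} {K : Gains} {J : Set ℝ} {x : ℝ → State} {t : ℝ}

lemma IsSolution.hasDerivWithinAt_v (hx : IsSolution P K J x) (ht : t ∈ J) :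
    HasDerivWithinAt (fun s => (x s).v) (P.g • e3 + r2 P K (x t)) J t := by
  rw [← velocity_rate]
  exact hx.velocity t ht

lemma IsSolution.hasDerivWithinAt_eP (hx : IsSolution P K J x) (ht : t ∈ J) :
    HasDerivWithinAt (fun s => eP P (x s)) (x t).v J t :=
  (hx.position t ht).sub_const P.pr

lemma IsSolution.hasDerivWithinAt_muD (hx : IsSolution P K J x) (ht : t ∈ J) :
    HasDerivWithinAt (fun s => muD P K (x s)) (muRate P K (x t)) J t :=
  ((hasDerivWithinAt_h (hx.hasDerivWithinAt_eP ht)).const_smul K.kp).fun_neg.fun_sub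
    ((hasDerivWithinAt_h (hx.hasDerivWithinAt_v ht)).const_smul K.kv)

lemma IsSolution.hasDerivWithinAt_QD (hx : IsSolution P K J x) (ht : t ∈ J)
    (hμ : ‖muD P K (x t)‖ < P.g) :
    HasDerivWithinAt (fun s => QD P K (x s))
      (quatRate (QD P K (x t)) (act (M P.g (muD P K (x t))) (muRate P K (x t)))) J t :=
  hasDerivWithinAt_attD (hx.hasDerivWithinAt_muD ht) hμ

lemma IsSolution.hasDerivWithinAt_Qerr_fst (hx : IsSolution P K J x) (ht : t ∈ J)
    (hμ : ‖muD P K (x t)‖ < P.g) (hQ : IsUnitQuat (x t).Q) :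
    HasDerivWithinAt (fun s => (Qerr P K (x s)).1)
      (-(1 / 2) * inner ℝ (Qerr P K (x t)).2
        (xi P K (x t) + act (RD P K (x t)).transpose (psi P K (x t)))) J t := by
  rw [← RD_transpose_omega_sub hμ hQ]
  exact hasDerivWithinAt_qmul_qinv_fst (hx.attitude t ht) (hx.hasDerivWithinAt_QD ht hμ)
    (isUnitQuat_QD hμ)

/-- Only the size of this rate matters later, so its formula is left unstated. The terms come from
the rate of the thrust, the rotation of its axis, and `δ`. -/
lemma IsSolution.exists_hasDerivWithinAt_r2 (hx : IsSolution P K J x) (ht : t ∈ J)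
    (hμ : ‖muD P K (x t)‖ < P.g) (hQ : IsUnitQuat (x t).Q) {δ' : E3}
    (hδ : HasDerivWithinAt (fun s => P.δ (x s).v) δ' J t) :
    ∃ r' : E3, HasDerivWithinAt (fun s => r2 P K (x s)) r' J t ∧
      ‖r'‖ ≤ ‖muRate P K (x t)‖ + uT P K (x t) * ‖omega P K (x t)‖ + ‖δ'‖ := by
  have h1 : HasDerivWithinAt (fun s => uT P K (x s)) _ J t :=
    hasDerivWithinAt_thrust (hx.hasDerivWithinAt_muD ht) hμ
  have h2 : HasDerivWithinAt (fun s => act (rot (x s).Q).transpose e3) _ J t :=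
    hasDerivWithinAt_rot_transpose (hx.attitude t ht) (hasDerivWithinAt_const t J e3) hQ
  refine ⟨_, (h1.fun_smul h2).fun_neg.fun_add hδ, ?_⟩
  refine (norm_add_le _ _).trans ?_
  gcongr
  rw [norm_neg, add_comm]
  refine (norm_add_le _ _).trans ?_
  rw [norm_smul, norm_smul, norm_rot_transpose hQ, norm_rot_transpose hQ, norm_e3, mul_one,
    zero_add, Real.norm_eq_abs, Real.norm_of_nonneg (uT_nonneg P K (x t))]
  refine add_le_add (abs_thrustRate_le hμ _) ?_
  refine mul_le_mul_of_nonneg_left ?_ (norm_nonneg _)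
  simpa [norm_e3] using norm_cross_le (omega P K (x t)) e3

lemma IsSolution.hasDerivWithinAt_r2err (hx : IsSolution P K J x) (ht : t ∈ J)
    (hμ : ∀ s ∈ J, ‖muD P K (x s)‖ < P.g) (hQ : ∀ s ∈ J, IsUnitQuat (x s).Q) (hk : K.k₁ ≠ 0)
    {r' : E3} (hr : HasDerivWithinAt (fun s => r2 P K (x s)) r' J t) :
    HasDerivWithinAt (fun s => r2err P K (x s))
      (-(K.k₁ • r2err P K (x t)) + cross (act (rot (Qerr P K (x t))) (r2 P K (x t))) (xi P K (x t))
        - (r' - act (rot (Qerr P K (x t))) r')) J t := by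
  have hμt := hμ t ht
  have hQt := hQ t ht
  -- With `R̃ = R_dᵀ R` the rate follows from the rates of two rotations, without differentiating
  -- `Q̃`.
  have e1 : ∀ s ∈ J, r2err P K (x s) = K.k₁ • ((x s).v - (x s).vhat) - (r2 P K (x s)
      - act (RD P K (x s)).transpose (act (rot (x s).Q) (r2 P K (x s)))) := by
    intro s hs
    rw [r2err, act_sub, act_one, rot_Qerr (hμ s hs) (hQ s hs)]
  have d1 := hasDerivWithinAt_rot (hx.attitude t ht) hr hQt
  have d2 : HasDerivWithinAt
      (fun s => act (RD P K (x s)).transpose (act (rot (x s).Q) (r2 P K (x s)))) _ J t :=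
    hasDerivWithinAt_rot_transpose (hx.hasDerivWithinAt_QD ht hμt) d1 (isUnitQuat_QD hμt)
  have d3 := (((hx.hasDerivWithinAt_v ht).fun_sub (hx.filter t ht)).const_smul K.k₁).fun_sub
    (hr.fun_sub d2)
  refine (d3.congr_of_mem e1 ht).congr_deriv ?_
  -- The terms in `ω` and `ω_d` merge into `ω - ω_d`, whose `ψ` part then cancels against
  -- `filter_rate`.
  have e2 : act (rot (QD P K (x t))).transpose (act (rot (x t).Q) r'
        - cross (omega P K (x t)) (act (rot (x t).Q) (r2 P K (x t)))
        + cross (act (M P.g (muD P K (x t))) (muRate P K (x t)))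
          (act (rot (x t).Q) (r2 P K (x t))))
      = act (rot (Qerr P K (x t))) r'
        + cross (act (rot (Qerr P K (x t))) (r2 P K (x t)))
          (xi P K (x t) + act (RD P K (x t)).transpose (psi P K (x t))) := by
    rw [← RD_transpose_omega_sub hμt hQt, rot_Qerr hμt hQt, rot_Qerr hμt hQt,
      ← RD_transpose_cross hμt, ← act_add_right, sub_add, ← cross_sub_left, cross_anticomm _
      (act (rot (x t).Q) (r2 P K (x t))), sub_neg_eq_add]
    rfl
  rw [e2, filter_rate hk hμt hQt, cross_add_right]
  abel

/-- The energy of the translational subsystem. -/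
def energy (P : Vehicle) (kp : ℝ) (X : State) : ℝ :=
  kp * (Real.sqrt (1 + ‖eP P X‖ ^ 2) - 1) + 1 / 2 * ‖X.v‖ ^ 2

lemma IsSolution.hasDerivWithinAt_energy (hx : IsSolution P K J x) (ht : t ∈ J) :
    HasDerivWithinAt (fun s => energy P K.kp (x s))
      (K.kp * inner ℝ (h (eP P (x t))) (x t).v
        + inner ℝ (x t).v (P.g • e3 + r2 P K (x t))) J t := by
  have h1 := ((hasDerivWithinAt_sqrt_one_add (hx.hasDerivWithinAt_eP ht)).sub_const 1).const_mul
    K.kp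
  have h2 := (hx.hasDerivWithinAt_v ht).norm_sq.const_mul (1 / 2)
  refine (h1.fun_add h2).congr_deriv ?_
  ring

end Rates

/-! ### Pointwise bounds -/

section Bounds

variable {P : Vehicle} {K : Gains} {X : State}

lemma uT_le (hp : 0 ≤ K.kp) (hv : 0 ≤ K.kv) (hg : K.kp + K.kv < P.g) :
    uT P K X ≤ P.g + K.kp + K.kv := by
  have := thrust_le P.g (by linarith) (muD P K X)
  have := norm_muD_le (P := P) (X := X) hp hv
  rw [uT]; linarith

lemma norm_Qerr_snd_le (hQ : IsUnitQuat (Qerr P K X)) : ‖(Qerr P K X).2‖ ≤ 1 := by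
  have h1 : (Qerr P K X).1 ^ 2 + ‖(Qerr P K X).2‖ ^ 2 = 1 := hQ
  nlinarith [sq_nonneg (Qerr P K X).1, norm_nonneg (Qerr P K X).2]

lemma abs_Qerr_fst_le (hQ : IsUnitQuat (Qerr P K X)) : |(Qerr P K X).1| ≤ 1 := by
  have h1 : (Qerr P K X).1 ^ 2 + ‖(Qerr P K X).2‖ ^ 2 = 1 := hQ
  rw [← sq_le_one_iff_abs_le_one]
  nlinarith [sq_nonneg ‖(Qerr P K X).2‖]

lemma norm_r2_le (hQ : IsUnitQuat X.Q) : ‖r2 P K X‖ ≤ uT P K X + ‖P.δ X.v‖ := by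
  rw [r2]
  refine (norm_add_le _ _).trans ?_
  rw [norm_neg, norm_smul, norm_rot_transpose hQ, norm_e3, mul_one,
    Real.norm_of_nonneg (uT_nonneg P K X)]

lemma norm_muRate_le (hp : 0 ≤ K.kp) (hv : 0 ≤ K.kv) (hg : 0 ≤ P.g) :
    ‖muRate P K X‖ ≤ K.kp * ‖X.v‖ + K.kv * (P.g + ‖r2 P K X‖) := by
  rw [muRate]
  refine (norm_sub_le _ _).trans ?_
  rw [norm_neg, norm_smul, norm_smul, Real.norm_of_nonneg hp, Real.norm_of_nonneg hv]
  gcongr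
  · exact norm_phi_le _ _
  · refine (norm_phi_le _ _).trans ((norm_add_le _ _).trans ?_)
    rw [norm_smul, norm_e3, mul_one, Real.norm_of_nonneg hg]

/-- A bound of the operator norm of `M(μ_d)`. -/
def boundM (g k : ℝ) : ℝ := (4 * k + 2 * (g + k)) / (g - k) ^ 2

lemma boundM_nonneg {g k : ℝ} (hk : 0 ≤ k) (hg : k < g) : 0 ≤ boundM g k := by
  have : 0 < g - k := by linarith
  have : 0 < g := by linarith
  rw [boundM]; positivity

lemma norm_xi_le (hp : 0 ≤ K.kp) (hv : 0 ≤ K.kv) (hg : K.kp + K.kv < P.g)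
    (hQ : IsUnitQuat X.Q) :
    ‖xi P K X‖
      ≤ boundM P.g (K.kp + K.kv) * (K.kv * (2 * ‖(Qerr P K X).2‖ * ‖r2 P K X‖)) := by
  have hμ := norm_muD_le (P := P) (X := X) hp hv
  have hμg := hμ.trans_lt hg
  rw [xi, RD, norm_rot_transpose (isUnitQuat_QD hμg)]
  refine (norm_M_le hμ hg _).trans ?_
  refine mul_le_mul_of_nonneg_left ?_ (boundM_nonneg (by positivity) hg)
  rw [norm_smul, Real.norm_of_nonneg hv]
  gcongr
  exact (norm_phi_le _ _).trans (norm_sub_rot_le (isUnitQuat_Qerr hμg hQ) _)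

lemma norm_psi_le (hμ : ‖muD P K X‖ < P.g) (hQ : IsUnitQuat X.Q) (h1 : 0 ≤ K.γ₁)
    (h2 : 0 ≤ K.γ₂) :
    ‖psi P K X‖ ≤ K.γ₁ * ‖P.r₁‖ ^ 2 + K.γ₂ * ‖r2 P K X‖ ^ 2
      + K.γ₂ * (‖r2err P K X‖ * ‖r2 P K X‖) := by
  have e : ‖psi P K X‖ = ‖act (RD P K X).transpose (psi P K X)‖ :=
    (norm_rot_transpose (isUnitQuat_QD hμ) _).symm
  have hc : ∀ a b : E3, ‖cross a (act (rot (Qerr P K X)) b)‖ ≤ ‖a‖ * ‖b‖ := by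
    intro a b
    refine (norm_cross_le _ _).trans ?_
    rw [norm_rot (isUnitQuat_Qerr hμ hQ)]
  rw [e, RD_transpose_psi hμ hQ]
  refine norm_add₃_le.trans ?_
  rw [norm_smul, norm_smul, norm_smul, Real.norm_of_nonneg h1, Real.norm_of_nonneg h2, pow_two,
    pow_two]
  gcongr <;> exact hc _ _

lemma norm_omega_le (hp : 0 ≤ K.kp) (hv : 0 ≤ K.kv) (hg : K.kp + K.kv < P.g)
    (hQ : IsUnitQuat X.Q) :
    ‖omega P K X‖ ≤ boundM P.g (K.kp + K.kv) * (‖muRate P K X‖ + K.kv * (2 * ‖r2 P K X‖))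
      + ‖psi P K X‖ := by
  have hμ := norm_muD_le (P := P) (X := X) hp hv
  have hμg := hμ.trans_lt hg
  have hq := norm_Qerr_snd_le (isUnitQuat_Qerr hμg hQ)
  rw [omega_eq hμg hQ]
  refine (norm_add_le _ _).trans ?_
  gcongr
  refine (norm_M_le hμ hg _).trans ?_
  refine mul_le_mul_of_nonneg_left ?_ (boundM_nonneg (by positivity) hg)
  refine (norm_add_le _ _).trans ?_
  rw [norm_smul, Real.norm_of_nonneg hv]
  gcongr
  refine (norm_phi_le _ _).trans ((norm_sub_rot_le (isUnitQuat_Qerr hμg hQ) _).trans ?_)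
  gcongr
  linarith

/-- The translational disturbance caused by the attitude error. -/
lemma norm_thrustErr_le (hp : 0 ≤ K.kp) (hv : 0 ≤ K.kv) (hg : K.kp + K.kv < P.g)
    (hQ : IsUnitQuat X.Q) :
    ‖uT P K X • (act (rot X.Q).transpose e3
        - act (rot (Qerr P K X)) (act (rot X.Q).transpose e3))‖
      ≤ (P.g + K.kp + K.kv) * (2 * ‖(Qerr P K X).2‖) := by
  have hμ := norm_muD_le (P := P) (X := X) hp hv
  have hμg := hμ.trans_lt hg
  rw [norm_smul, Real.norm_of_nonneg (uT_nonneg P K X)]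
  have h1 := norm_sub_rot_le (isUnitQuat_Qerr hμg hQ) (act (rot X.Q).transpose e3)
  rw [norm_rot_transpose hQ, norm_e3, mul_one] at h1
  have := uT_le (P := P) (X := X) hp hv hg
  have := uT_nonneg P K X
  have hc : 0 ≤ P.g + K.kp + K.kv := by linarith
  gcongr

/-- The term `-k_p h(e_p)` in `μ_d` cancels the rate of the potential, `-k_v h(v)` dissipates, and
`δ` does no positive work. Only the thrust misalignment can add energy. -/
lemma energyRate_le (hp : 0 ≤ K.kp) (hv : 0 ≤ K.kv) (hg : K.kp + K.kv < P.g)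
    (hQ : IsUnitQuat X.Q) (hδ : inner ℝ (P.δ X.v) X.v ≤ 0) :
    K.kp * inner ℝ (h (eP P X)) X.v + inner ℝ X.v (P.g • e3 + r2 P K X)
      ≤ -(K.kv * (‖X.v‖ ^ 2 / Real.sqrt (1 + ‖X.v‖ ^ 2)))
        + (P.g + K.kp + K.kv) * (2 * ‖(Qerr P K X).2‖) * ‖X.v‖ := by
  have hμ := norm_muD_le (P := P) (X := X) hp hv
  have hμg := hμ.trans_lt hg
  rw [velocity_rate_eq hμg hQ, muD, inner_sub_right, inner_add_right, inner_sub_right,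
    inner_neg_right, inner_smul_right, inner_smul_right, inner_self_h,
    real_inner_comm X.v (h (eP P X))]
  have h1 := norm_thrustErr_le (P := P) (X := X) hp hv hg hQ
  have h2 := real_inner_le_norm X.v (-(uT P K X • (act (rot X.Q).transpose e3
        - act (rot (Qerr P K X)) (act (rot X.Q).transpose e3))))
  rw [inner_neg_right, norm_neg] at h2
  have h3 := mul_le_mul_of_nonneg_left h1 (norm_nonneg X.v)
  rw [real_inner_comm] at hδ
  linarith

/-- The rate of `‖q̃‖² = 1 - η̃²`. -/
lemma attErrRate_le {w γ : ℝ} (hp : 0 ≤ K.kp) (hv : 0 ≤ K.kv) (hg : K.kp + K.kv < P.g)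
    (hQ : IsUnitQuat X.Q) (hγ : 0 ≤ γ) (h1 : γ ≤ K.γ₁) (h2 : γ ≤ K.γ₂)
    (hw : ∀ y : E3, w * ‖y‖ ^ 2 ≤ ‖cross y P.r₁‖ ^ 2 + ‖cross y (r2 P K X)‖ ^ 2) :
    -(2 * (Qerr P K X).1 * (-(1 / 2) * inner ℝ (Qerr P K X).2
        (xi P K X + act (RD P K X).transpose (psi P K X))))
      ≤ -(2 * (Qerr P K X).1 ^ 2 * (γ * (w * ‖(Qerr P K X).2‖ ^ 2)))
        + K.γ₂ * (‖(Qerr P K X).2‖ * (‖r2err P K X‖ * ‖r2 P K X‖))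
        + ‖(Qerr P K X).2‖ * ‖xi P K X‖ := by
  have hμg := (norm_muD_le (P := P) (X := X) hp hv).trans_lt hg
  have hQe := isUnitQuat_Qerr hμg hQ
  have hη := abs_Qerr_fst_le hQe
  rw [RD_transpose_psi hμg hQ, inner_add_right, inner_add_right, inner_add_right,
    inner_smul_right, inner_smul_right, inner_smul_right, inner_cross_rot, inner_cross_rot]
  have hwq := hw (Qerr P K X).2
  have a1 : |(Qerr P K X).1 * inner ℝ (Qerr P K X).2 (xi P K X)|
      ≤ 1 * (‖(Qerr P K X).2‖ * ‖xi P K X‖) := by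
    rw [abs_mul]
    gcongr
    exact abs_real_inner_le_norm _ _
  have a2 : |(Qerr P K X).1 * inner ℝ (Qerr P K X).2
        (cross (r2err P K X) (act (rot (Qerr P K X)) (r2 P K X)))|
      ≤ 1 * (‖(Qerr P K X).2‖ * (‖r2err P K X‖ * ‖r2 P K X‖)) := by
    rw [abs_mul]
    gcongr
    refine (abs_real_inner_le_norm _ _).trans ?_
    gcongr
    refine (norm_cross_le _ _).trans ?_
    rw [norm_rot hQe]
  have a3 := (le_abs_self _).trans a1
  have a4 := mul_le_mul_of_nonneg_left ((le_abs_self _).trans a2) (hγ.trans h2)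
  have a5 : γ * (w * ‖(Qerr P K X).2‖ ^ 2) ≤ K.γ₁ * ‖cross (Qerr P K X).2 P.r₁‖ ^ 2
      + K.γ₂ * ‖cross (Qerr P K X).2 (r2 P K X)‖ ^ 2 := by
    calc _ ≤ γ * (‖cross (Qerr P K X).2 P.r₁‖ ^ 2 + ‖cross (Qerr P K X).2 (r2 P K X)‖ ^ 2) := by
          gcongr
      _ = γ * ‖cross (Qerr P K X).2 P.r₁‖ ^ 2 + γ * ‖cross (Qerr P K X).2 (r2 P K X)‖ ^ 2 := by
          ring
      _ ≤ _ := by gcongr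
  have a6 := mul_le_mul_of_nonneg_left a5 (by positivity : 0 ≤ 2 * (Qerr P K X).1 ^ 2)
  linarith

lemma filterErrRate_le (hp : 0 ≤ K.kp) (hv : 0 ≤ K.kv) (hg : K.kp + K.kv < P.g)
    (hQ : IsUnitQuat X.Q) (r' : E3) :
    inner ℝ (r2err P K X) (-(K.k₁ • r2err P K X)
        + cross (act (rot (Qerr P K X)) (r2 P K X)) (xi P K X)
        - (r' - act (rot (Qerr P K X)) r'))
      ≤ -(K.k₁ * ‖r2err P K X‖ ^ 2)
        + ‖r2err P K X‖ * (‖r2 P K X‖ * ‖xi P K X‖ + 2 * ‖(Qerr P K X).2‖ * ‖r'‖) := by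
  have hμg := (norm_muD_le (P := P) (X := X) hp hv).trans_lt hg
  have hQe := isUnitQuat_Qerr hμg hQ
  rw [add_sub_assoc, inner_add_right, inner_neg_right, inner_smul_right,
    real_inner_self_eq_norm_sq]
  gcongr
  refine (real_inner_le_norm _ _).trans ?_
  gcongr
  refine (norm_sub_le _ _).trans ?_
  gcongr
  · refine (norm_cross_le _ _).trans ?_
    rw [norm_rot hQe]
  · exact norm_sub_rot_le hQe _

end Bounds

/-! ### The smallest eigenvalue -/

lemma isHermitian_W (a b : ℝ) (r₁ r₂ : E3) : (W a b r₁ r₂).IsHermitian := by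
  rw [Matrix.IsHermitian, Matrix.conjTranspose_eq_transpose_of_trivial]
  simp [W, Matrix.transpose_pow, S_transpose]

open Matrix in
-- `A - λ_min I` is Hermitian with nonnegative spectrum, hence positive semidefinite. Finiteness of
-- the spectrum makes its infimum a lower bound.
lemma lambdaMin_mul_norm_sq_le {A : Mat3} (hA : A.IsHermitian) (y : E3) :
    lambdaMin A * ‖y‖ ^ 2 ≤ inner ℝ y (act A y) := by
  have hfin : (spectrum ℝ A).Finite := A.finite_real_spectrum
  have h1 : (A - algebraMap ℝ Mat3 (lambdaMin A)).PosSemidef := by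
    rw [Matrix.posSemidef_iff_isHermitian_and_spectrum_nonneg]
    refine ⟨?_, ?_⟩
    · refine hA.sub ?_
      rw [Algebra.algebraMap_eq_smul_one, Matrix.IsHermitian]
      simp
    · intro z hz
      rw [← spectrum.sub_singleton_eq] at hz
      obtain ⟨w, hw, z', rfl, rfl⟩ := hz
      exact sub_nonneg.2 (csInf_le hfin.bddBelow hw)
  have h2 := h1.dotProduct_mulVec_nonneg y.ofLp
  have h3 : inner ℝ y (act A y) - lambdaMin A * ‖y‖ ^ 2
      = star y.ofLp ⬝ᵥ (A - algebraMap ℝ Mat3 (lambdaMin A)).mulVec y.ofLp := by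
    rw [Algebra.algebraMap_eq_smul_one, Matrix.sub_mulVec, Matrix.smul_mulVec, Matrix.one_mulVec,
      norm_sq_coord, inner_coord]
    simp [act, Matrix.toLpLin_apply, dotProduct, Fin.sum_univ_three]
    ring
  linarith

lemma inner_act_W (a b : ℝ) (r₁ r₂ y : E3) :
    inner ℝ y (act (W a b r₁ r₂) y) = a * ‖cross y r₁‖ ^ 2 + b * ‖cross y r₂‖ ^ 2 := by
  rw [W, act_sub, ← neg_smul, act_smul, act_smul, act_S_sq, act_S_sq]
  simp only [norm_sq_coord, inner_coord, PiLp.sub_apply, PiLp.smul_apply,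
    smul_eq_mul, cross_apply_zero, cross_apply_one, cross_apply_two]
  ring

/-! ### Differential inequalities -/

lemma Icc_subset_timeInterval {t₀ t : ℝ} {T : EReal} (ht : t ∈ timeInterval t₀ T) :
    Set.Icc t₀ t ⊆ timeInterval t₀ T :=
  fun _ hs => ⟨hs.1, lt_of_le_of_lt (EReal.coe_le_coe_iff.2 hs.2) ht.2⟩

lemma le_initial_of_deriv_nonpos {f f' : ℝ → ℝ} {J : Set ℝ} {a b : ℝ} (hab : a ≤ b)
    (hJ : Set.Icc a b ⊆ J) (hf : ∀ t ∈ J, HasDerivWithinAt f (f' t) J t)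
    (hf' : ∀ t ∈ Set.Ioo a b, f' t ≤ 0) : f b ≤ f a := by
  have h := antitoneOn_of_hasDerivWithinAt_nonpos (convex_Icc a b) (f := f) (f' := f')
    (fun t ht => ((hf t (hJ ht)).mono hJ).continuousWithinAt)
    (fun t ht => (hf t (hJ (interior_subset ht))).mono (interior_subset.trans hJ))
    (fun t ht => hf' t (by rwa [interior_Icc] at ht))
  exact h (Set.left_mem_Icc.2 hab) (Set.right_mem_Icc.2 hab) hab

/-- Two quantities that do not increase as long as both stay below given levels, and which start
below these levels, never increase. -/
lemma le_initial_of_bootstrap {f₁ f₂ f₁' f₂' : ℝ → ℝ} {t₀ : ℝ} {T : EReal} {b₁ b₂ : ℝ}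
    (h₁ : ∀ t ∈ timeInterval t₀ T, HasDerivWithinAt f₁ (f₁' t) (timeInterval t₀ T) t)
    (h₂ : ∀ t ∈ timeInterval t₀ T, HasDerivWithinAt f₂ (f₂' t) (timeInterval t₀ T) t)
    (hb₁ : f₁ t₀ < b₁) (hb₂ : f₂ t₀ < b₂)
    (h : ∀ t ∈ timeInterval t₀ T, f₁ t ≤ b₁ → f₂ t ≤ b₂ → f₁' t ≤ 0 ∧ f₂' t ≤ 0) :
    ∀ t ∈ timeInterval t₀ T, f₁ t ≤ f₁ t₀ ∧ f₂ t ≤ f₂ t₀ := by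
  have step : ∀ t ∈ timeInterval t₀ T, (∀ s ∈ Set.Ioo t₀ t, f₁ s ≤ b₁ ∧ f₂ s ≤ b₂) →
      f₁ t ≤ f₁ t₀ ∧ f₂ t ≤ f₂ t₀ := by
    intro t ht hs
    have hJ := Icc_subset_timeInterval ht
    have hd : ∀ s ∈ Set.Ioo t₀ t, f₁' s ≤ 0 ∧ f₂' s ≤ 0 := fun s hst =>
      h s (hJ (Set.Ioo_subset_Icc_self hst)) (hs s hst).1 (hs s hst).2
    exact ⟨le_initial_of_deriv_nonpos ht.1 hJ h₁ fun s hst => (hd s hst).1,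
      le_initial_of_deriv_nonpos ht.1 hJ h₂ fun s hst => (hd s hst).2⟩
  have key : ∀ t ∈ timeInterval t₀ T, f₁ t ≤ b₁ ∧ f₂ t ≤ b₂ := by
    intro t ht
    by_contra hcon
    have hJ := Icc_subset_timeInterval ht
    have c₁ : ContinuousOn f₁ (Set.Icc t₀ t) :=
      fun s hs => ((h₁ s (hJ hs)).mono hJ).continuousWithinAt
    have c₂ : ContinuousOn f₂ (Set.Icc t₀ t) :=
      fun s hs => ((h₂ s (hJ hs)).mono hJ).continuousWithinAt
    have c : ContinuousOn (fun s => max (f₁ s - b₁) (f₂ s - b₂)) (Set.Icc t₀ t) :=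
      ContinuousOn.sup (c₁.sub continuousOn_const) (c₂.sub continuousOn_const)
    have hcl : IsCompact (Set.Icc t₀ t ∩ (fun s => max (f₁ s - b₁) (f₂ s - b₂)) ⁻¹' Set.Ici 0) :=
      isCompact_Icc.of_isClosed_subset (c.preimage_isClosed_of_isClosed isClosed_Icc isClosed_Ici)
        Set.inter_subset_left
    have hne : (Set.Icc t₀ t ∩
        (fun s => max (f₁ s - b₁) (f₂ s - b₂)) ⁻¹' Set.Ici 0).Nonempty := by
      refine ⟨t, ⟨ht.1, le_rfl⟩, ?_⟩
      simp only [Set.mem_preimage, Set.mem_Ici, le_max_iff, sub_nonneg]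
      by_contra hc
      push Not at hc
      exact hcon ⟨hc.1.le, hc.2.le⟩
    -- `s` is the first time at which a level is reached. Up to `s` neither function has increased,
    -- so both are still strictly below their levels: a contradiction.
    obtain ⟨s, ⟨hs, hs0⟩, hmin⟩ := hcl.exists_isLeast hne
    have hlt : ∀ r ∈ Set.Ioo t₀ s, f₁ r ≤ b₁ ∧ f₂ r ≤ b₂ := by
      intro r hr
      by_contra hc
      have : s ≤ r := hmin ⟨⟨hr.1.le, hr.2.le.trans hs.2⟩, by
        simp only [Set.mem_preimage, Set.mem_Ici, le_max_iff, sub_nonneg]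
        by_contra hc'
        push Not at hc'
        exact hc ⟨hc'.1.le, hc'.2.le⟩⟩
      exact absurd hr.2 (not_lt.2 this)
    obtain ⟨k₁, k₂⟩ := step s (hJ hs) hlt
    simp only [Set.mem_preimage, Set.mem_Ici, le_max_iff, sub_nonneg] at hs0
    rcases hs0 with h0 | h0 <;> linarith
  exact fun t ht => step t ht fun s hs =>
    key s (Icc_subset_timeInterval ht (Set.Ioo_subset_Icc_self hs))

/-- Integrating factor: `f(s) exp(β (s - t₀))` does not increase. -/
lemma le_exp_of_deriv_le {f f' : ℝ → ℝ} {t₀ β : ℝ}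
    (hf : ∀ t ∈ Set.Ici t₀, HasDerivWithinAt f (f' t) (Set.Ici t₀) t)
    (hf' : ∀ t ∈ Set.Ici t₀, f' t ≤ -(β * f t)) {t : ℝ} (ht : t₀ ≤ t) :
    f t ≤ f t₀ * Real.exp (-(β * (t - t₀))) := by
  have hd : ∀ s ∈ Set.Ici t₀, HasDerivWithinAt (fun s => f s * Real.exp (β * (s - t₀)))
      ((f' s + β * f s) * Real.exp (β * (s - t₀))) (Set.Ici t₀) s := by
    intro s hs
    have h1 : HasDerivWithinAt (fun s => β * (s - t₀)) (β * 1) (Set.Ici t₀) s :=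
      ((hasDerivWithinAt_id s _).sub_const t₀).const_mul β
    refine ((hf s hs).fun_mul h1.exp).congr_deriv ?_
    ring
  have h := le_initial_of_deriv_nonpos ht (fun s hs => hs.1) hd fun s hs => by
    have h2 := hf' s hs.1.le
    have h3 := Real.exp_pos (β * (s - t₀))
    exact mul_nonpos_of_nonpos_of_nonneg (by linarith) h3.le
  simp only [sub_self, mul_zero, Real.exp_zero, mul_one] at h
  rw [Real.exp_neg, ← div_eq_mul_inv, le_div_iff₀ (Real.exp_pos _)]
  exact h

lemma tendsto_zero_of_sq_le_exp {E : Type*} [SeminormedAddCommGroup E] {y : ℝ → E}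
    {t₀ β C : ℝ} (hβ : 0 < β)
    (hy : ∀ t, t₀ ≤ t → ‖y t‖ ^ 2 ≤ C * Real.exp (-(β * (t - t₀)))) :
    Filter.Tendsto y Filter.atTop (nhds 0) := by
  have h1 : Filter.Tendsto (fun t => C * Real.exp (-(β * (t - t₀)))) Filter.atTop (nhds 0) := by
    have h2 : Filter.Tendsto (fun t => β * (t - t₀)) Filter.atTop Filter.atTop :=
      (Filter.tendsto_atTop_add_const_right _ (-t₀) Filter.tendsto_id).const_mul_atTop hβ
    simpa using (Real.tendsto_exp_neg_atTop_nhds_zero.comp h2).const_mul C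
  have h3 : Filter.Tendsto (fun t => ‖y t‖ ^ 2) Filter.atTop (nhds 0) :=
    squeeze_zero' (Filter.Eventually.of_forall fun t => by positivity)
      ((Filter.eventually_ge_atTop t₀).mono hy) h1
  have h4 := h3.sqrt
  simp only [Real.sqrt_sq (norm_nonneg _), Real.sqrt_zero] at h4
  exact tendsto_zero_iff_norm_tendsto_zero.2 h4

lemma IsSolution.isUnitQuat {P : Vehicle} {K : Gains} {t₀ : ℝ} {T : EReal} {x : ℝ → State}
    (hx : IsSolution P K (timeInterval t₀ T) x) (h₀ : IsUnitQuat (x t₀).Q) :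
    ∀ t ∈ timeInterval t₀ T, IsUnitQuat (x t).Q := by
  intro t ht
  have hd := fun s hs => hasDerivWithinAt_quat_norm_sq (hx.attitude s hs)
  have hJ := Icc_subset_timeInterval ht
  have h1 := le_initial_of_deriv_nonpos ht.1 hJ hd fun _ _ => le_rfl
  have h2 := le_initial_of_deriv_nonpos ht.1 hJ (fun s hs => (hd s hs).fun_neg)
    fun _ _ => neg_zero.le
  have h3 : (x t₀).Q.1 ^ 2 + ‖(x t₀).Q.2‖ ^ 2 = 1 := h₀
  rw [IsUnitQuat]
  linarith

/-! ### The Lyapunov function of the attitude and filter errors -/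

/-- The Lyapunov function `‖q̃‖² + a ‖r̃₂‖²`, with `‖q̃‖² = 1 - η̃²`. -/
def attLyapunov (a : ℝ) (P : Vehicle) (K : Gains) (X : State) : ℝ :=
  1 - (Qerr P K X).1 ^ 2 + a * ‖r2err P K X‖ ^ 2

lemma attLyapunov_eq {a : ℝ} {P : Vehicle} {K : Gains} {X : State}
    (hQ : IsUnitQuat (Qerr P K X)) :
    attLyapunov a P K X = ‖(Qerr P K X).2‖ ^ 2 + a * ‖r2err P K X‖ ^ 2 := by
  have h : (Qerr P K X).1 ^ 2 + ‖(Qerr P K X).2‖ ^ 2 = 1 := hQ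
  rw [attLyapunov]; linarith

/-- Here `q = ‖q̃‖`, `z = ‖r̃₂‖`, `e = η̃`, and `A + D z` bounds the rate of `r₂`. The mixed terms
add up to `G q z ≤ q² + G²/4 z²`. The gain `γ` pays for the `q²` terms: decay `Λ`, this Young term,
and `2 kv m rb` from `xi`. The gain `k₁` pays for the `z²` terms. -/
lemma attLyapunovRate_bound {q z e w γ γ₂ k₁ kv m rb A D a Λ ε dq dz G : ℝ}
    (hq1 : q ≤ 1) (ha : 0 ≤ a) (hD : 0 ≤ D)
    (hw : 0 ≤ w) (hγ : 0 ≤ γ) (he : ε ^ 2 / 4 ≤ e ^ 2)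
    (hdq : dq ≤ -(2 * e ^ 2 * (γ * (w * q ^ 2))) + γ₂ * (q * (z * rb))
      + q * (m * (kv * (2 * q * rb))))
    (hdz : dz ≤ -(k₁ * z ^ 2) + z * (rb * (m * (kv * (2 * q * rb))) + 2 * q * (A + D * z)))
    (hG : G = γ₂ * rb + 4 * a * (m * kv * rb ^ 2 + A))
    (hΛγ : Λ + 1 + 2 * kv * m * rb ≤ ε ^ 2 / 2 * w * γ)
    (hΛk : G ^ 2 / 4 + a * Λ ≤ 2 * a * (k₁ - 2 * D)) :
    dq + a * (2 * dz) ≤ -(Λ * (q ^ 2 + a * z ^ 2)) := by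
  have h1 : (Λ + 1 + 2 * kv * m * rb) * q ^ 2 ≤ 2 * e ^ 2 * (γ * (w * q ^ 2)) := by
    calc _ ≤ (ε ^ 2 / 2 * w * γ) * q ^ 2 := by gcongr
      _ = 2 * (ε ^ 2 / 4) * (γ * (w * q ^ 2)) := by ring
      _ ≤ _ := by gcongr
  have h2 : D * z ^ 2 * q ≤ D * z ^ 2 * 1 := by gcongr
  have h3 : a * dz ≤ a * (-(k₁ * z ^ 2) + 2 * (m * kv * rb ^ 2 + A) * (q * z) + 2 * D * z ^ 2) := by
    gcongr
    linarith
  have h4 : (G ^ 2 / 4 + a * Λ) * z ^ 2 ≤ 2 * a * (k₁ - 2 * D) * z ^ 2 := by gcongr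
  have h5 : G * (q * z) ≤ q ^ 2 + G ^ 2 / 4 * z ^ 2 := by nlinarith [sq_nonneg (q - G * z / 2)]
  rw [hG] at h5
  rw [hG] at h4
  linarith

/-- The derivative exists at every time, but its bound is conditional on `‖v‖ ≤ vb` and `η̃² ≥
ε²/4`; this is the form that the bootstrap consumes. -/
lemma IsSolution.exists_attLyapunovRate {P : Vehicle} {K : Gains} {J : Set ℝ} {x : ℝ → State}
    {t : ℝ} {c₁ c₂ c₃ vb rb μb A w γ a Λ ε G : ℝ}
    (hx : IsSolution P K J x) (hQ : ∀ s ∈ J, IsUnitQuat (x s).Q)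
    (hp : 0 ≤ K.kp) (hv : 0 ≤ K.kv) (hg : K.kp + K.kv < P.g) (hk₁ : 0 < K.k₁)
    (hc₁ : 0 ≤ c₁) (hc₃ : 0 ≤ c₃) (hγ : 0 ≤ γ) (hγ₁ : γ ≤ K.γ₁) (hγ₂ : γ ≤ K.γ₂) (ha : 0 ≤ a)
    (hw : 0 ≤ w) (hrb : P.g + K.kp + K.kv + c₁ * vb ^ 2 ≤ rb)
    (hμb : K.kp * vb + K.kv * (P.g + rb) ≤ μb)
    (hA : μb + (P.g + K.kp + K.kv) * (boundM P.g (K.kp + K.kv) * (μb + K.kv * (2 * rb))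
      + (K.γ₁ * ‖P.r₁‖ ^ 2 + K.γ₂ * rb ^ 2)) + (c₂ + c₃ * vb ^ 3) ≤ A)
    (hG : G = K.γ₂ * rb + 4 * a * (boundM P.g (K.kp + K.kv) * K.kv * rb ^ 2 + A))
    (hΛγ : Λ + 1 + 2 * K.kv * boundM P.g (K.kp + K.kv) * rb ≤ ε ^ 2 / 2 * w * γ)
    (hΛk : G ^ 2 / 4 + a * Λ ≤ 2 * a * (K.k₁ - 2 * ((P.g + K.kp + K.kv) * K.γ₂ * rb)))
    (ht : t ∈ J) (hδ : ‖P.δ (x t).v‖ ≤ c₁ * ‖(x t).v‖ ^ 2)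
    (hδ' : DisturbanceRate c₂ c₃ P J x)
    (hW : ∀ y : E3, w * ‖y‖ ^ 2 ≤ ‖cross y P.r₁‖ ^ 2 + ‖cross y (r2 P K (x t))‖ ^ 2) :
    ∃ L' : ℝ, HasDerivWithinAt (fun s => attLyapunov a P K (x s)) L' J t ∧
      (‖(x t).v‖ ≤ vb → ε ^ 2 / 4 ≤ (Qerr P K (x t)).1 ^ 2 →
        L' ≤ -(Λ * attLyapunov a P K (x t))) := by
  have hμ : ∀ s, ‖muD P K (x s)‖ < P.g := fun s => (norm_muD_le hp hv).trans_lt hg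
  have hQt := hQ t ht
  have hQe := isUnitQuat_Qerr (hμ t) hQt
  obtain ⟨r', hr, hr'⟩ := hx.exists_hasDerivWithinAt_r2 ht (hμ t) hQt
    (hδ' t ht).1.hasDerivWithinAt
  have d1 := hx.hasDerivWithinAt_Qerr_fst ht (hμ t) hQt
  have d2 := hx.hasDerivWithinAt_r2err ht (fun s _ => hμ s) hQ hk₁.ne' hr
  have d3 := ((d1.fun_pow 2).const_sub 1).fun_add (d2.norm_sq.const_mul a)
  refine ⟨_, d3, fun hvb he => ?_⟩
  rw [attLyapunov_eq hQe]
  have hg0 : 0 < P.g := by linarith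
  have hm := boundM_nonneg (add_nonneg hp hv) hg
  have hvb0 : 0 ≤ vb := (norm_nonneg _).trans hvb
  have hγ₂0 := hγ.trans hγ₂
  have huT := uT_le (P := P) (X := x t) hp hv hg
  have hr2 : ‖r2 P K (x t)‖ ≤ rb := by
    have h1 := norm_r2_le (P := P) (K := K) hQt
    have h2 : c₁ * ‖(x t).v‖ ^ 2 ≤ c₁ * vb ^ 2 := by gcongr
    linarith
  have hrb0 : 0 ≤ rb := (norm_nonneg _).trans hr2
  have hq := norm_Qerr_snd_le hQe
  have hxi : ‖xi P K (x t)‖ ≤ boundM P.g (K.kp + K.kv)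
      * (K.kv * (2 * ‖(Qerr P K (x t)).2‖ * rb)) :=
    (norm_xi_le hp hv hg hQt).trans (by gcongr)
  have hmu : ‖muRate P K (x t)‖ ≤ μb := by
    refine (norm_muRate_le hp hv hg0.le).trans (le_trans ?_ hμb)
    gcongr
  have hpsi : ‖psi P K (x t)‖ ≤ K.γ₁ * ‖P.r₁‖ ^ 2 + K.γ₂ * rb ^ 2
      + K.γ₂ * (‖r2err P K (x t)‖ * rb) :=
    (norm_psi_le (hμ t) hQt (hγ.trans hγ₁) hγ₂0).trans (by gcongr)
  have hom : ‖omega P K (x t)‖ ≤ boundM P.g (K.kp + K.kv) * (μb + K.kv * (2 * rb))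
      + (K.γ₁ * ‖P.r₁‖ ^ 2 + K.γ₂ * rb ^ 2 + K.γ₂ * (‖r2err P K (x t)‖ * rb)) :=
    (norm_omega_le hp hv hg hQt).trans (by gcongr)
  -- The rate of `r₂` contains `u_t ω`, and `ω` contains `ψ`, so its bound is affine in the filter
  -- error.
  have hrn : ‖r'‖ ≤ A + (P.g + K.kp + K.kv) * K.γ₂ * rb * ‖r2err P K (x t)‖ := by
    have h1 : uT P K (x t) * ‖omega P K (x t)‖ ≤ (P.g + K.kp + K.kv)
        * (boundM P.g (K.kp + K.kv) * (μb + K.kv * (2 * rb))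
      + (K.γ₁ * ‖P.r₁‖ ^ 2 + K.γ₂ * rb ^ 2 + K.γ₂ * (‖r2err P K (x t)‖ * rb))) :=
      mul_le_mul huT hom (norm_nonneg _) (by positivity)
    have h2 := (hδ' t ht).2
    have h3 : c₃ * ‖(x t).v‖ ^ 3 ≤ c₃ * vb ^ 3 := by gcongr
    linarith
  have hdq := attErrRate_le hp hv hg hQt hγ hγ₁ hγ₂ hW
  have hdz := filterErrRate_le hp hv hg hQt r'
  have hdq2 := hdq.trans (b := _) (c := -(2 * (Qerr P K (x t)).1 ^ 2
      * (γ * (w * ‖(Qerr P K (x t)).2‖ ^ 2)))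
        + K.γ₂ * (‖(Qerr P K (x t)).2‖ * (‖r2err P K (x t)‖ * rb))
        + ‖(Qerr P K (x t)).2‖ * (boundM P.g (K.kp + K.kv)
      * (K.kv * (2 * ‖(Qerr P K (x t)).2‖ * rb)))) (by gcongr)
  have hdz2 := hdz.trans (b := _) (c := -(K.k₁ * ‖r2err P K (x t)‖ ^ 2)
        + ‖r2err P K (x t)‖ * (rb * (boundM P.g (K.kp + K.kv)
      * (K.kv * (2 * ‖(Qerr P K (x t)).2‖ * rb))) + 2 * ‖(Qerr P K (x t)).2‖ *
        (A + (P.g + K.kp + K.kv) * K.γ₂ * rb * ‖r2err P K (x t)‖))) (by gcongr)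
  have hfin := attLyapunovRate_bound hq ha (by positivity) hw hγ he
    hdq2 hdz2 hG hΛγ hΛk
  refine le_trans (le_of_eq ?_) hfin
  push_cast
  ring

/-! ### Boundedness -/

section

variable {P : Vehicle} {K : Gains} {x : ℝ → State} {t₀ : ℝ} {T : EReal}

lemma norm_v_sq_le {kp : ℝ} (hp : 0 ≤ kp) (X : State) : ‖X.v‖ ^ 2 ≤ 2 * energy P kp X := by
  have h1 : 1 ≤ Real.sqrt (1 + ‖eP P X‖ ^ 2) := Real.one_le_sqrt.2 (by linarith [sq_nonneg ‖eP P X‖])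
  have h2 : 0 ≤ kp * (Real.sqrt (1 + ‖eP P X‖ ^ 2) - 1) := mul_nonneg hp (by linarith)
  rw [energy]; linarith

lemma norm_eP_le {kp : ℝ} (hp : 0 < kp) (X : State) : ‖eP P X‖ ≤ energy P kp X / kp + 1 := by
  have h1 := norm_le_sqrt_one_add (eP P X)
  have h2 : Real.sqrt (1 + ‖eP P X‖ ^ 2) - 1 ≤ energy P kp X / kp := by
    rw [le_div_iff₀ hp, energy]
    nlinarith [sq_nonneg ‖X.v‖]
  linarith

/-- On a bounded set the saturated dissipation is still quadratic. -/
lemma sq_div_sqrt_bound {s b : ℝ} (hs : 0 ≤ s) (hb : s ≤ b) :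
    s ^ 2 / Real.sqrt (1 + b ^ 2) ≤ s ^ 2 / Real.sqrt (1 + s ^ 2) := by
  have : 0 < Real.sqrt (1 + s ^ 2) := Real.sqrt_pos.2 (by positivity)
  gcongr

lemma energyRate_le_of_norm_le {X : State} {vb : ℝ} (hp : 0 ≤ K.kp) (hv : 0 ≤ K.kv)
    (hg : K.kp + K.kv < P.g) (hQ : IsUnitQuat X.Q) (hδ : inner ℝ (P.δ X.v) X.v ≤ 0)
    (hvb : ‖X.v‖ ≤ vb) :
    K.kp * inner ℝ (h (eP P X)) X.v + inner ℝ X.v (P.g • e3 + r2 P K X)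
      ≤ -(K.kv / Real.sqrt (1 + vb ^ 2) * ‖X.v‖ ^ 2)
        + 2 * (P.g + K.kp + K.kv) * ‖(Qerr P K X).2‖ * ‖X.v‖ := by
  have h1 := energyRate_le hp hv hg hQ hδ
  have h2 := mul_le_mul_of_nonneg_left (sq_div_sqrt_bound (norm_nonneg X.v) hvb) hv
  have h3 : K.kv * (‖X.v‖ ^ 2 / Real.sqrt (1 + vb ^ 2))
      = K.kv / Real.sqrt (1 + vb ^ 2) * ‖X.v‖ ^ 2 := by ring
  linarith

lemma IsSolution.bounded_of_attLyapunovRate {a Λ ε vb : ℝ} {L' : ℝ → ℝ}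
    (hx : IsSolution P K (timeInterval t₀ T) x)
    (hQ : ∀ s ∈ timeInterval t₀ T, IsUnitQuat (x s).Q)
    (hp : 0 ≤ K.kp) (hv : 0 < K.kv) (hg : K.kp + K.kv < P.g)
    (hδ : ∀ v, inner ℝ (P.δ v) v ≤ 0) (ha : 0 ≤ a) (hε : ε ≠ 0)
    (hL : ∀ t ∈ timeInterval t₀ T,
      HasDerivWithinAt (fun s => attLyapunov a P K (x s)) (L' t) (timeInterval t₀ T) t)
    (hL' : ∀ t ∈ timeInterval t₀ T, ‖(x t).v‖ ≤ vb → ε ^ 2 / 4 ≤ (Qerr P K (x t)).1 ^ 2 →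
      L' t ≤ -(Λ * attLyapunov a P K (x t)))
    (hvb0 : 0 ≤ vb) (hvb : 2 * (energy P K.kp (x t₀) + 1) ≤ vb ^ 2)
    (hΛ : 2 * ((P.g + K.kp + K.kv) ^ 2 / (K.kv / Real.sqrt (1 + vb ^ 2))) ≤ Λ)
    (hL0 : attLyapunov a P K (x t₀) ≤ 1 - ε ^ 2 / 2) :
    ∀ t ∈ timeInterval t₀ T, energy P K.kp (x t) ≤ energy P K.kp (x t₀) + 1 ∧
      ‖(x t).v‖ ≤ vb ∧ L' t ≤ -(Λ * attLyapunov a P K (x t)) := by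
  have hε2 : 0 < ε ^ 2 := by positivity
  have hσ : 0 < K.kv / Real.sqrt (1 + vb ^ 2) := by positivity
  have hLe : ∀ t ∈ timeInterval t₀ T, ‖(Qerr P K (x t)).2‖ ^ 2 ≤ attLyapunov a P K (x t) := by
    intro t ht
    rw [attLyapunov_eq (isUnitQuat_Qerr ((norm_muD_le hp hv.le).trans_lt hg) (hQ t ht))]
    have : 0 ≤ a * ‖r2err P K (x t)‖ ^ 2 := by positivity
    linarith
  -- The levels imply the provisos: `L ≥ 0` leaves `‖v‖² ≤ 2 (V(t₀) + 1) ≤ vb²`, and `1 - η̃² ≤ L ≤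
  -- 1 - ε²/4`.
  have below : ∀ t ∈ timeInterval t₀ T,
      energy P K.kp (x t) + 1 / 2 * attLyapunov a P K (x t) ≤ energy P K.kp (x t₀) + 1 →
      attLyapunov a P K (x t) ≤ 1 - ε ^ 2 / 4 →
      ‖(x t).v‖ ≤ vb ∧ ε ^ 2 / 4 ≤ (Qerr P K (x t)).1 ^ 2 := by
    intro t ht h1 h2
    have h3 := hLe t ht
    have h4 := norm_v_sq_le (P := P) hp (x t)
    refine ⟨?_, ?_⟩
    · apply le_of_sq_le_sq _ hvb0
      nlinarith [sq_nonneg ‖(Qerr P K (x t)).2‖]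
    · have h5 : 0 ≤ a * ‖r2err P K (x t)‖ ^ 2 := by positivity
      rw [attLyapunov] at h2
      linarith
  have hV := fun t ht => hx.hasDerivWithinAt_energy (t := t) ht
  have hdecr : ∀ t ∈ timeInterval t₀ T,
      energy P K.kp (x t) + 1 / 2 * attLyapunov a P K (x t) ≤ energy P K.kp (x t₀) + 1 →
      attLyapunov a P K (x t) ≤ 1 - ε ^ 2 / 4 →
      (K.kp * inner ℝ (h (eP P (x t))) (x t).v
        + inner ℝ (x t).v (P.g • e3 + r2 P K (x t))) + 1 / 2 * L' t ≤ 0 ∧ L' t ≤ 0 := by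
    intro t ht h1 h2
    obtain ⟨h3, h4⟩ := below t ht h1 h2
    have h5 := hL' t ht h3 h4
    have h6 := energyRate_le_of_norm_le hp hv.le hg (hQ t ht) (hδ _) h3
    have h7 := hLe t ht
    generalize attLyapunov a P K (x t) = L at *
    generalize ‖(Qerr P K (x t)).2‖ = q at *
    generalize K.kv / Real.sqrt (1 + vb ^ 2) = σ at *
    generalize ‖(x t).v‖ = v at *
    have hΛ0 : 0 ≤ Λ := le_trans (by positivity) hΛ
    have hL0 : 0 ≤ L := (sq_nonneg q).trans h7
    have hΛL : 0 ≤ Λ * L := mul_nonneg hΛ0 hL0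
    -- Completing the square in the misalignment term costs `(c²/σ) ‖q̃‖²` with `c = g + k_p + k_v`;
    -- the lower bound on `Λ` lets the decay of `L/2` absorb it.
    have h8 : (P.g + K.kp + K.kv) ^ 2 / σ * q ^ 2 ≤ 1 / 2 * (Λ * L) := by
      calc _ ≤ (Λ / 2) * L := mul_le_mul (by linarith) h7 (sq_nonneg q) (by linarith)
        _ = _ := by ring
    have h9 : 2 * (P.g + K.kp + K.kv) * q * v
        ≤ σ * v ^ 2 + (P.g + K.kp + K.kv) ^ 2 / σ * q ^ 2 := by
      have h10 : σ * v ^ 2 + (P.g + K.kp + K.kv) ^ 2 / σ * q ^ 2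
          - 2 * (P.g + K.kp + K.kv) * q * v = (σ * v - (P.g + K.kp + K.kv) * q) ^ 2 / σ := by
        field_simp
        ring
      have h11 : 0 ≤ (σ * v - (P.g + K.kp + K.kv) * q) ^ 2 / σ := by positivity
      linarith
    exact ⟨by linarith, by linarith⟩
  have hboot := le_initial_of_bootstrap
    (b₁ := energy P K.kp (x t₀) + 1) (b₂ := 1 - ε ^ 2 / 4)
    (fun t ht => (hV t ht).fun_add ((hL t ht).const_mul (1 / 2))) hL (by linarith) (by linarith)
    hdecr
  intro t ht
  obtain ⟨h1, h2⟩ := hboot t ht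
  have h3 := (sq_nonneg _).trans (hLe t ht)
  obtain ⟨h4, h5⟩ := below t ht (by linarith) (by linarith)
  exact ⟨by linarith, h4, hL' t ht h4 h5⟩

/-! ### Convergence -/

lemma sqrt_one_add_sub_one_le (s : ℝ) : Real.sqrt (1 + s ^ 2) - 1 ≤ s ^ 2 / 2 := by
  have : Real.sqrt (1 + s ^ 2) ≤ 1 + s ^ 2 / 2 :=
    Real.sqrt_le_iff.2 ⟨by positivity, by nlinarith [sq_nonneg (s ^ 2)]⟩
  linarith

lemma le_sqrt_one_add_sub_one {s b : ℝ} (hs : 0 ≤ s) (hb : s ≤ b) :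
    s ^ 2 / (2 * Real.sqrt (1 + b ^ 2)) ≤ Real.sqrt (1 + s ^ 2) - 1 := by
  have h1 : Real.sqrt (1 + s ^ 2) ≤ Real.sqrt (1 + b ^ 2) := by gcongr
  have h2 : 1 ≤ Real.sqrt (1 + s ^ 2) := Real.one_le_sqrt.2 (by nlinarith [sq_nonneg s])
  have h3 : Real.sqrt (1 + s ^ 2) ^ 2 = 1 + s ^ 2 := Real.sq_sqrt (by positivity)
  rw [div_le_iff₀ (by positivity)]
  have h4 : (Real.sqrt (1 + s ^ 2) - 1) * (Real.sqrt (1 + s ^ 2) + 1)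
      ≤ (Real.sqrt (1 + s ^ 2) - 1) * (2 * Real.sqrt (1 + b ^ 2)) :=
    mul_le_mul_of_nonneg_left (by linarith) (by linarith)
  linarith

/-- The energy rate has no damping in `e_p`; the cross term `e_pᵀ v` supplies it through `-k_p e_pᵀ
h(e_p)`. -/
lemma inner_eP_velocityRate_le {X : State} {eb vb c₁ : ℝ} (hp : 0 ≤ K.kp) (hv : 0 ≤ K.kv)
    (hg : K.kp + K.kv < P.g) (hc₁ : 0 ≤ c₁) (hQ : IsUnitQuat X.Q)
    (hδ : ‖P.δ X.v‖ ≤ c₁ * ‖X.v‖ ^ 2) (hvb : ‖X.v‖ ≤ vb) (heb : ‖eP P X‖ ≤ eb) :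
    inner ℝ (eP P X) (P.g • e3 + r2 P K X)
      ≤ -(K.kp / Real.sqrt (1 + eb ^ 2) * ‖eP P X‖ ^ 2)
        + ‖eP P X‖ * ((K.kv + c₁ * vb) * ‖X.v‖
          + 2 * (P.g + K.kp + K.kv) * ‖(Qerr P K X).2‖) := by
  have hμg := (norm_muD_le (P := P) (X := X) hp hv).trans_lt hg
  have e1 : P.g • e3 + r2 P K X = -(K.kp • h (eP P X)) + (-(K.kv • h X.v) + P.δ X.v
      + -(uT P K X • (act (rot X.Q).transpose e3
        - act (rot (Qerr P K X)) (act (rot X.Q).transpose e3)))) := by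
    rw [velocity_rate_eq hμg hQ, muD]; abel
  rw [e1, inner_add_right, inner_neg_right, inner_smul_right, inner_self_h]
  have h1 : K.kp / Real.sqrt (1 + eb ^ 2) * ‖eP P X‖ ^ 2
      ≤ K.kp * (‖eP P X‖ ^ 2 / Real.sqrt (1 + ‖eP P X‖ ^ 2)) := by
    have := mul_le_mul_of_nonneg_left (sq_div_sqrt_bound (norm_nonneg _) heb) hp
    calc _ = K.kp * (‖eP P X‖ ^ 2 / Real.sqrt (1 + eb ^ 2)) := by ring
      _ ≤ _ := this
  refine add_le_add (neg_le_neg h1) ((real_inner_le_norm _ _).trans ?_)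
  gcongr
  refine norm_add₃_le.trans ?_
  rw [norm_neg, norm_neg, norm_smul, Real.norm_of_nonneg hv]
  have h2 := mul_le_mul_of_nonneg_left (norm_h_le X.v) hv
  have h3 := norm_thrustErr_le (P := P) (X := X) hp hv hg hQ
  have h4 : c₁ * ‖X.v‖ ^ 2 ≤ c₁ * vb * ‖X.v‖ := by
    rw [pow_two, mul_assoc]; gcongr
  linarith

lemma IsSolution.tendsto_zero {a Λ eb vb c₁ : ℝ} {L' : ℝ → ℝ}
    (hx : IsSolution P K (Set.Ici t₀) x) (hQ : ∀ s ∈ Set.Ici t₀, IsUnitQuat (x s).Q)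
    (hp : 0 < K.kp) (hv : 0 < K.kv) (hg : K.kp + K.kv < P.g) (hc₁ : 0 ≤ c₁)
    (hδ : ∀ v, inner ℝ (P.δ v) v ≤ 0) (hδb : ∀ v, ‖P.δ v‖ ≤ c₁ * ‖v‖ ^ 2)
    (ha : 0 ≤ a) (hΛ : 0 < Λ)
    (hL : ∀ t ∈ Set.Ici t₀,
      HasDerivWithinAt (fun s => attLyapunov a P K (x s)) (L' t) (Set.Ici t₀) t)
    (hL' : ∀ t ∈ Set.Ici t₀, L' t ≤ -(Λ * attLyapunov a P K (x t)))
    (hvb : ∀ t ∈ Set.Ici t₀, ‖(x t).v‖ ≤ vb) (heb : ∀ t ∈ Set.Ici t₀, ‖eP P (x t)‖ ≤ eb) :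
    Filter.Tendsto (fun t => eP P (x t)) Filter.atTop (nhds 0) ∧
      Filter.Tendsto (fun t => (x t).v) Filter.atTop (nhds 0) := by
  have hvb0 : 0 ≤ vb := (norm_nonneg _).trans (hvb t₀ Set.self_mem_Ici)
  set c := P.g + K.kp + K.kv with hc
  set σ := K.kv / Real.sqrt (1 + vb ^ 2) with hσ
  set κ := K.kp / Real.sqrt (1 + eb ^ 2) with hκ
  set b := K.kv + c₁ * vb with hb
  have hσ0 : 0 < σ := by positivity
  have hκ0 : 0 < κ := by positivity
  -- The bounds `1/2` and `κ/2` keep the function positive definite despite the cross term. The last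
  -- bound lets a quarter of the damping `σ ‖v‖²` absorb the `‖v‖²` terms created by the cross term.
  obtain ⟨α, hα0, hα1, hα2, hα3⟩ : ∃ α : ℝ, 0 < α ∧ α ≤ 1 / 2 ∧ α ≤ κ / 2 ∧
      α * (1 + b ^ 2 / κ) ≤ σ / 4 := by
    have h1 : 0 < 1 + b ^ 2 / κ := by positivity
    refine ⟨min (1 / 2) (min (κ / 2) (σ / 4 / (1 + b ^ 2 / κ))), by positivity, min_le_left _ _,
      (min_le_right _ _).trans (min_le_left _ _), ?_⟩
    rw [← le_div_iff₀ h1]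
    exact (min_le_right _ _).trans (min_le_right _ _)
  -- `N` collects the coefficients of `‖q̃‖²` left by completing squares. With `n Λ = N + 1`, the
  -- decay of `n L` covers them and retains `-L`.
  set N := 4 * c ^ 2 / σ + 4 * α * c ^ 2 / κ with hN
  have hN0 : 0 ≤ N := by positivity
  set n := (N + 1) / Λ with hn
  have hn0 : 0 < n := by positivity
  have hnΛ : n * Λ = N + 1 := by rw [hn]; field_simp
  set H := K.kp + 1 + n with hH
  have hH0 : 0 < H := by positivity
  -- The surviving damping is `σ/2` in `‖v‖²`, `α κ/2` in `‖e_p‖²` and `1` in `L`; `H` bounds the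
  -- Lyapunov function by the sum of these three quantities.
  set β := min (σ / 2) (min (α * κ / 2) 1) / H with hβ
  have hβ0 : 0 < β := by positivity
  have hLe : ∀ t ∈ Set.Ici t₀, ‖(Qerr P K (x t)).2‖ ^ 2 ≤ attLyapunov a P K (x t) := by
    intro t ht
    rw [attLyapunov_eq (isUnitQuat_Qerr ((norm_muD_le hp.le hv.le).trans_lt hg) (hQ t ht))]
    have : 0 ≤ a * ‖r2err P K (x t)‖ ^ 2 := by positivity
    linarith
  have hd : ∀ t ∈ Set.Ici t₀, HasDerivWithinAt (fun s => energy P K.kp (x s)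
      + α * inner ℝ (eP P (x s)) (x s).v + n * attLyapunov a P K (x s)) _ (Set.Ici t₀) t :=
    fun t ht => ((hx.hasDerivWithinAt_energy ht).fun_add
      (((hx.hasDerivWithinAt_eP ht).inner ℝ (hx.hasDerivWithinAt_v ht)).const_mul α)).fun_add
      ((hL t ht).const_mul n)
  have hZ : ∀ t ∈ Set.Ici t₀, κ / 4 * ‖eP P (x t)‖ ^ 2 + 1 / 4 * ‖(x t).v‖ ^ 2
      ≤ energy P K.kp (x t) + α * inner ℝ (eP P (x t)) (x t).v
        + n * attLyapunov a P K (x t) ∧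
      energy P K.kp (x t) + α * inner ℝ (eP P (x t)) (x t).v + n * attLyapunov a P K (x t)
      ≤ H * (‖eP P (x t)‖ ^ 2 + ‖(x t).v‖ ^ 2 + attLyapunov a P K (x t)) := by
    intro t ht
    have h1 := abs_le.1 (abs_real_inner_le_norm (eP P (x t)) (x t).v)
    have h2 := hLe t ht
    have h3 := mul_le_mul_of_nonneg_left (le_sqrt_one_add_sub_one (norm_nonneg _) (heb t ht)) hp.le
    have h4 := mul_le_mul_of_nonneg_left (sqrt_one_add_sub_one_le ‖eP P (x t)‖) hp.le
    have h5 : K.kp * (‖eP P (x t)‖ ^ 2 / (2 * Real.sqrt (1 + eb ^ 2)))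
        = κ / 2 * ‖eP P (x t)‖ ^ 2 := by rw [hκ]; field_simp
    rw [h5] at h3
    rw [energy]
    generalize attLyapunov a P K (x t) = L at *
    have hL0 : 0 ≤ L := (sq_nonneg _).trans h2
    generalize K.kp * (Real.sqrt (1 + ‖eP P (x t)‖ ^ 2) - 1) = E at *
    generalize inner ℝ (eP P (x t)) (x t).v = I at *
    have he0 := norm_nonneg (eP P (x t))
    have hv0 := norm_nonneg (x t).v
    generalize ‖eP P (x t)‖ = e at *
    generalize ‖(x t).v‖ = v at *
    have h6 : e * v ≤ (e ^ 2 + v ^ 2) / 2 := by nlinarith [sq_nonneg (e - v)]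
    have h7 : α * I ≤ α * ((e ^ 2 + v ^ 2) / 2) :=
      mul_le_mul_of_nonneg_left (by linarith) hα0.le
    have h8 : α * (-I) ≤ α * ((e ^ 2 + v ^ 2) / 2) :=
      mul_le_mul_of_nonneg_left (by linarith) hα0.le
    have h9 : α * e ^ 2 ≤ κ / 2 * e ^ 2 := by gcongr
    have h10 : α * v ^ 2 ≤ 1 / 2 * v ^ 2 := by gcongr
    have h11 : α * e ^ 2 ≤ 1 / 2 * e ^ 2 := by gcongr
    have h12 : 0 ≤ n * L := by positivity
    refine ⟨by linarith, ?_⟩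
    have h13 : 0 ≤ n * e ^ 2 := by positivity
    have h14 : 0 ≤ n * v ^ 2 := by positivity
    have h15 : 0 ≤ K.kp * e ^ 2 := by positivity
    have h16 : 0 ≤ K.kp * v ^ 2 := by positivity
    have h17 : 0 ≤ K.kp * L := by positivity
    rw [hH]
    linarith [sq_nonneg e, sq_nonneg v]
  have hrate : ∀ t ∈ Set.Ici t₀, (K.kp * inner ℝ (h (eP P (x t))) (x t).v
        + inner ℝ (x t).v (P.g • e3 + r2 P K (x t)))
      + α * (inner ℝ (eP P (x t)) (P.g • e3 + r2 P K (x t)) + inner ℝ (x t).v (x t).v)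
      + n * L' t ≤ -(β * (energy P K.kp (x t) + α * inner ℝ (eP P (x t)) (x t).v
        + n * attLyapunov a P K (x t))) := by
    intro t ht
    have h1 := energyRate_le_of_norm_le hp.le hv.le hg (hQ t ht) (hδ _) (hvb t ht)
    have h2 := inner_eP_velocityRate_le hp.le hv.le hg hc₁ (hQ t ht) (hδb _) (hvb t ht) (heb t ht)
    have h3 := mul_le_mul_of_nonneg_left (hL' t ht) hn0.le
    have h4 := hLe t ht
    have h5 := mul_le_mul_of_nonneg_left (hZ t ht).2 hβ0.le
    have h6 : n * -(Λ * attLyapunov a P K (x t)) = -((N + 1) * attLyapunov a P K (x t)) := by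
      rw [← hnΛ]; ring
    rw [h6] at h3
    rw [real_inner_self_eq_norm_sq]
    have h7 := mul_le_mul_of_nonneg_left h2 hα0.le
    rw [← hc, ← hσ] at h1
    rw [← hc, ← hκ, ← hb] at h7
    have hβH : β * H = min (σ / 2) (min (α * κ / 2) 1) := by rw [hβ]; field_simp
    rw [← mul_assoc, hβH] at h5
    have m1 : min (σ / 2) (min (α * κ / 2) 1) ≤ σ / 2 := min_le_left _ _
    have m2 : min (σ / 2) (min (α * κ / 2) 1) ≤ α * κ / 2 :=
      (min_le_right _ _).trans (min_le_left _ _)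
    have m3 : min (σ / 2) (min (α * κ / 2) 1) ≤ 1 := (min_le_right _ _).trans (min_le_right _ _)
    generalize min (σ / 2) (min (α * κ / 2) 1) = m at *
    generalize attLyapunov a P K (x t) = L at *
    have hL0 : 0 ≤ L := (sq_nonneg _).trans h4
    generalize ‖(Qerr P K (x t)).2‖ = q at *
    generalize ‖eP P (x t)‖ = e at *
    generalize ‖(x t).v‖ = v at *
    have k1 : m * v ^ 2 ≤ σ / 2 * v ^ 2 := by gcongr
    have k2 : m * e ^ 2 ≤ α * κ / 2 * e ^ 2 := by gcongr
    have k3 : m * L ≤ 1 * L := by gcongr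
    have k4 : 2 * c * q * v ≤ σ / 4 * v ^ 2 + 4 * c ^ 2 / σ * q ^ 2 := by
      have : σ / 4 * v ^ 2 + 4 * c ^ 2 / σ * q ^ 2 - 2 * c * q * v
          = (σ * v - 4 * c * q) ^ 2 / (4 * σ) := by field_simp; ring
      have : 0 ≤ (σ * v - 4 * c * q) ^ 2 / (4 * σ) := by positivity
      linarith
    have k5 : α * (e * (b * v)) ≤ α * (κ / 4 * e ^ 2 + b ^ 2 / κ * v ^ 2) := by
      gcongr
      have : κ / 4 * e ^ 2 + b ^ 2 / κ * v ^ 2 - e * (b * v)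
          = (κ * e - 2 * b * v) ^ 2 / (4 * κ) := by field_simp; ring
      have : 0 ≤ (κ * e - 2 * b * v) ^ 2 / (4 * κ) := by positivity
      linarith
    have k6 : α * (e * (2 * c * q)) ≤ α * (κ / 4 * e ^ 2 + 4 * c ^ 2 / κ * q ^ 2) := by
      gcongr
      have : κ / 4 * e ^ 2 + 4 * c ^ 2 / κ * q ^ 2 - e * (2 * c * q)
          = (κ * e - 4 * c * q) ^ 2 / (4 * κ) := by field_simp; ring
      have : 0 ≤ (κ * e - 4 * c * q) ^ 2 / (4 * κ) := by positivity
      linarith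
    have k7 : α * (1 + b ^ 2 / κ) * v ^ 2 ≤ σ / 4 * v ^ 2 := by gcongr
    have k8 : N * q ^ 2 ≤ N * L := by gcongr
    have k9 : N * q ^ 2 = 4 * c ^ 2 / σ * q ^ 2 + α * (4 * c ^ 2 / κ * q ^ 2) := by
      rw [hN]; ring
    linarith
  have hexp := fun t (ht : t₀ ≤ t) => le_exp_of_deriv_le hd hrate ht
  set Z₀ := energy P K.kp (x t₀) + α * inner ℝ (eP P (x t₀)) (x t₀).v
    + n * attLyapunov a P K (x t₀)
  refine ⟨tendsto_zero_of_sq_le_exp (t₀ := t₀) (C := 4 / κ * Z₀) hβ0 fun t ht => ?_,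
    tendsto_zero_of_sq_le_exp (t₀ := t₀) (C := 4 * Z₀) hβ0 fun t ht => ?_⟩
  · have h1 := (hZ t ht).1
    have h2 := hexp t ht
    have h3 : κ / 4 * ‖eP P (x t)‖ ^ 2 ≤ Z₀ * Real.exp (-(β * (t - t₀))) := by
      linarith [sq_nonneg ‖(x t).v‖]
    calc _ = 4 / κ * (κ / 4 * ‖eP P (x t)‖ ^ 2) := by field_simp
      _ ≤ 4 / κ * (Z₀ * Real.exp (-(β * (t - t₀)))) := by gcongr
      _ = _ := by ring
  · have h1 := (hZ t ht).1
    have h2 := hexp t ht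
    have h3 : 0 ≤ κ / 4 * ‖eP P (x t)‖ ^ 2 := by positivity
    linarith

end

/-! ### Choice of the gains and the closed-loop theorem -/

lemma timeInterval_top (t₀ : ℝ) : timeInterval t₀ ⊤ = Set.Ici t₀ := by
  ext t; simp [timeInterval, EReal.coe_lt_top]

lemma NonCollinear.mul_norm_sq_le {cw : ℝ → ℝ → ℝ} {P : Vehicle} {K : Gains} {J : Set ℝ}
    {x : ℝ → State} (hN : NonCollinear cw P K J x) {t : ℝ} (ht : t ∈ J) (y : E3) :
    cw 1 1 * ‖y‖ ^ 2 ≤ ‖cross y P.r₁‖ ^ 2 + ‖cross y (r2 P K (x t))‖ ^ 2 := by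
  have h1 := hN 1 1 one_pos one_pos t ht
  have h2 := lambdaMin_mul_norm_sq_le (isHermitian_W 1 1 P.r₁ (r2 P K (x t))) y
  rw [inner_act_W, one_mul, one_mul] at h2
  exact (mul_le_mul_of_nonneg_right h1.le (sq_nonneg _)).trans h2

end

end VTOL

theorem mainTheorem1
    (g kp kv : ℝ) (hkp : 0 < kp) (hkv : 0 < kv) (hg : kp + kv < g)
    (r₁ pr : VTOL.E3)
    -- the aerodynamic disturbance: dissipative, and quadratically bounded
    (δ : VTOL.E3 → VTOL.E3) (c₁ c₂ c₃ : ℝ) (hc₁ : 0 < c₁) (hc₂ : 0 < c₂) (hc₃ : 0 < c₃)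
    (hδ_diss : ∀ v, inner ℝ (δ v) v ≤ 0)
    (hδ_bound : ∀ v, ‖δ v‖ ≤ c₁ * ‖v‖ ^ 2)
    -- the lower bound of the smallest eigenvalue of `W`
    (cw : ℝ → ℝ → ℝ) (hcw : ∀ a b, 0 < a → 0 < b → 0 < cw a b)
    (t₀ : ℝ) :
    -- bounds of the thrust, for all positive gains and all solutions
    (∀ γ₁ γ₂ k₁ : ℝ, 0 < γ₁ → 0 < γ₂ → 0 < k₁ →
      ∀ (T : EReal) (x : ℝ → VTOL.State),
        VTOL.IsSolution ⟨g, r₁, δ, pr⟩ ⟨kp, kv, γ₁, γ₂, k₁⟩ (VTOL.timeInterval t₀ T) x →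
        ∀ t ∈ VTOL.timeInterval t₀ T,
          0 < g - kp - kv ∧
          g - kp - kv ≤ VTOL.uT ⟨g, r₁, δ, pr⟩ ⟨kp, kv, γ₁, γ₂, k₁⟩ (x t) ∧
          VTOL.uT ⟨g, r₁, δ, pr⟩ ⟨kp, kv, γ₁, γ₂, k₁⟩ (x t) ≤ g + kp + kv) ∧
    -- boundedness and convergence, for all initial conditions with nonzero `η̃(t₀)`;
    -- `B` bounds the initial filter error
    (∀ (p₀ v₀ : VTOL.E3) (Q₀ : ℝ × VTOL.E3) (B : ℝ), VTOL.IsUnitQuat Q₀ →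
      (VTOL.qmul Q₀ (VTOL.qinv (VTOL.attD g (-(kp • VTOL.h (p₀ - pr)) - kv • VTOL.h v₀)))).1 ≠ 0 →
      ∃ γ₁bar > 0, ∃ γ₂bar > 0, ∀ γ₁ > γ₁bar, ∀ γ₂ > γ₂bar,
        ∃ κ₁ > 0, ∀ k₁ > κ₁,
          ∀ (T : EReal) (x : ℝ → VTOL.State),
            VTOL.IsSolution ⟨g, r₁, δ, pr⟩ ⟨kp, kv, γ₁, γ₂, k₁⟩ (VTOL.timeInterval t₀ T) x →
            VTOL.NonCollinear cw ⟨g, r₁, δ, pr⟩ ⟨kp, kv, γ₁, γ₂, k₁⟩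
              (VTOL.timeInterval t₀ T) x →
            VTOL.DisturbanceRate c₂ c₃ ⟨g, r₁, δ, pr⟩ (VTOL.timeInterval t₀ T) x →
            (x t₀).p = p₀ → (x t₀).v = v₀ → (x t₀).Q = Q₀ →
            ‖VTOL.r2err ⟨g, r₁, δ, pr⟩ ⟨kp, kv, γ₁, γ₂, k₁⟩ (x t₀)‖ ≤ B →
            (∃ C : ℝ, ∀ t ∈ VTOL.timeInterval t₀ T, ‖(x t).p - pr‖ ≤ C ∧ ‖(x t).v‖ ≤ C) ∧
            (T = ⊤ →
              Filter.Tendsto (fun t => (x t).p - pr) Filter.atTop (nhds 0) ∧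
              Filter.Tendsto (fun t => (x t).v) Filter.atTop (nhds 0))) := by
  refine ⟨?_, ?_⟩
  · intro γ₁ γ₂ k₁ _ _ _ T x _ t _
    have hμ := VTOL.norm_muD_le (P := ⟨g, r₁, δ, pr⟩) (K := ⟨kp, kv, γ₁, γ₂, k₁⟩) (X := x t)
      hkp.le hkv.le
    have h1 := VTOL.le_thrust g (by linarith)
      (VTOL.muD ⟨g, r₁, δ, pr⟩ ⟨kp, kv, γ₁, γ₂, k₁⟩ (x t))
    have h2 := VTOL.thrust_le g (by linarith)
      (VTOL.muD ⟨g, r₁, δ, pr⟩ ⟨kp, kv, γ₁, γ₂, k₁⟩ (x t))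
    simp only [VTOL.uT]
    exact ⟨by linarith, by linarith, by linarith⟩
  intro p₀ v₀ Q₀ B hQ₀ hε
  set ε := (VTOL.qmul Q₀ (VTOL.qinv (VTOL.attD g (-(kp • VTOL.h (p₀ - pr))
    - kv • VTOL.h v₀)))).1 with hεdef
  set E₀ := kp * (Real.sqrt (1 + ‖p₀ - pr‖ ^ 2) - 1) + 1 / 2 * ‖v₀‖ ^ 2 with hE₀
  have hE₀0 : 0 ≤ E₀ := by
    have h1 : 1 ≤ Real.sqrt (1 + ‖p₀ - pr‖ ^ 2) :=
      Real.one_le_sqrt.2 (by linarith [sq_nonneg ‖p₀ - pr‖])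
    have h2 : 0 ≤ kp * (Real.sqrt (1 + ‖p₀ - pr‖ ^ 2) - 1) := mul_nonneg hkp.le (by linarith)
    positivity
  have hg0 : 0 < g := by linarith
  -- Unit weights suffice: the common lower bound `γ` of both gains is factored out of the quadratic
  -- form.
  have hw := hcw 1 1 one_pos one_pos
  set w := cw 1 1 with hwdef
  -- The speed bound comes from the initial energy plus a margin of one, independently of `γ₁`,
  -- `γ₂`, `k₁`; so do `rb`, `μb` and `Λ`.
  set vb := Real.sqrt (2 * (E₀ + 1)) with hvb
  have hvb0 : 0 ≤ vb := Real.sqrt_nonneg _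
  have hvb2 : vb ^ 2 = 2 * (E₀ + 1) := Real.sq_sqrt (by positivity)
  set m := VTOL.boundM g (kp + kv) with hm
  have hm0 : 0 ≤ m := VTOL.boundM_nonneg (by positivity) hg
  set rb := g + kp + kv + c₁ * vb ^ 2 with hrb
  set μb := kp * vb + kv * (g + rb) with hμb
  set Λ := 2 * ((g + kp + kv) ^ 2 / (kv / Real.sqrt (1 + vb ^ 2))) + 1 with hΛ
  have hΛ0 : 0 < Λ := by positivity
  have hrb0 : 0 < rb := by positivity
  -- Chosen so that `hΛγ` below holds with equality.
  set γ := 2 * (Λ + 1 + 2 * kv * m * rb) / (ε ^ 2 * w) with hγ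
  have hγ0 : 0 < γ := by positivity
  refine ⟨γ, hγ0, γ, hγ0, fun γ₁ hγ₁ γ₂ hγ₂ => ?_⟩
  have hγ₁0 : 0 < γ₁ := hγ0.trans hγ₁
  have hγ₂0 : 0 < γ₂ := hγ0.trans hγ₂
  -- The weight keeps the share of the initial filter error in `L(t₀)` below `ε²/2`, hence `L(t₀) ≤
  -- 1 - ε²/2`. The `+ 1` avoids division by zero when `B = 0`.
  set a := ε ^ 2 / (2 * (B ^ 2 + 1)) with ha
  have ha0 : 0 < a := by positivity
  set A := μb + (g + kp + kv) * (m * (μb + kv * (2 * rb)) + (γ₁ * ‖r₁‖ ^ 2 + γ₂ * rb ^ 2))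
    + (c₂ + c₃ * vb ^ 3) with hA
  set G := γ₂ * rb + 4 * a * (m * kv * rb ^ 2 + A) with hG
  -- `A` and `G` grow with `γ₁` and `γ₂`, so the threshold of `k₁` must come after them; it is `hΛk`
  -- solved for `k₁`.
  set κ := 2 * ((g + kp + kv) * γ₂ * rb) + (G ^ 2 / 4 + a * Λ) / (2 * a) with hκ
  have hκ0 : 0 < κ := by positivity
  refine ⟨κ, hκ0, fun k₁ hk₁ T x hx hN hδ' hp₀ hv₀ hQx hB => ?_⟩
  set P : VTOL.Vehicle := ⟨g, r₁, δ, pr⟩ with hP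
  set K : VTOL.Gains := ⟨kp, kv, γ₁, γ₂, k₁⟩ with hK
  have hQ := hx.isUnitQuat (by rwa [hQx])
  have hΛγ : Λ + 1 + 2 * kv * m * rb ≤ ε ^ 2 / 2 * w * γ := by
    rw [hγ]; apply le_of_eq; field_simp
  have hΛk : G ^ 2 / 4 + a * Λ ≤ 2 * a * (k₁ - 2 * ((g + kp + kv) * γ₂ * rb)) := by
    have h1 : (G ^ 2 / 4 + a * Λ) / (2 * a) ≤ k₁ - 2 * ((g + kp + kv) * γ₂ * rb) := by linarith
    rwa [div_le_iff₀' (by positivity)] at h1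
  have hrate := fun t ht => hx.exists_attLyapunovRate (c₁ := c₁) (c₂ := c₂) (c₃ := c₃) (vb := vb)
    (rb := rb) (μb := μb) (A := A) (w := w) (γ := γ) (a := a) (Λ := Λ) (ε := ε) (G := G) (t := t)
    hQ hkp.le hkv.le hg (hκ0.trans hk₁) hc₁.le hc₃.le hγ0.le hγ₁.le hγ₂.le ha0.le hw.le le_rfl
    le_rfl le_rfl rfl hΛγ hΛk ht (hδ_bound _) hδ' (hN.mul_norm_sq_le ht)
  choose! L' hL hL' using hrate
  have hen : VTOL.energy P kp (x t₀) = E₀ := by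
    simp only [VTOL.energy, VTOL.eP, hp₀, hv₀, hE₀, hP]
  have hη : (VTOL.Qerr P K (x t₀)).1 = ε := by
    simp only [VTOL.Qerr, VTOL.QD, VTOL.muD, VTOL.eP, hp₀, hv₀, hQx, hεdef, hP, hK]
  have hL0 : VTOL.attLyapunov a P K (x t₀) ≤ 1 - ε ^ 2 / 2 := by
    rw [VTOL.attLyapunov, hη]
    have h1 : a * ‖VTOL.r2err P K (x t₀)‖ ^ 2 ≤ a * (B ^ 2 + 1) := by
      gcongr
      have : ‖VTOL.r2err P K (x t₀)‖ ^ 2 ≤ B ^ 2 := by gcongr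
      linarith
    have h2 : a * (B ^ 2 + 1) = ε ^ 2 / 2 := by rw [ha]; field_simp
    linarith
  have hbd := hx.bounded_of_attLyapunovRate hQ hkp.le hkv hg hδ_diss ha0.le hε hL hL' hvb0
    (by rw [hvb2]; exact (congrArg (fun e => 2 * (e + 1)) hen).le) (by linarith) hL0
  have heb : ∀ t ∈ VTOL.timeInterval t₀ T, ‖VTOL.eP P (x t)‖ ≤ (E₀ + 1) / kp + 1 := by
    intro t ht
    refine (VTOL.norm_eP_le hkp (x t)).trans ?_
    have h1 := (hbd t ht).1
    rw [show VTOL.energy P K.kp (x t₀) = E₀ from hen] at h1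
    gcongr
  refine ⟨⟨max ((E₀ + 1) / kp + 1) vb, fun t ht =>
    ⟨(heb t ht).trans (le_max_left _ _), (hbd t ht).2.1.trans (le_max_right _ _)⟩⟩, ?_⟩
  rintro rfl
  rw [VTOL.timeInterval_top] at *
  exact hx.tendsto_zero hQ hkp hkv hg hc₁.le hδ_diss hδ_bound ha0.le hΛ0 hL
    (fun t ht => (hbd t ht).2.2) (fun t ht => (hbd t ht).2.1) heb
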